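/- Let $f(n) := n^{2/3}(\ln n)^{1/3}$, fix constants $\alpha>0$ and $\beta\ge 1/6$, and for $n\ge 1$ put $s=s(n):=\min\{\lceil\alpha f(n)\rceil,\,n-1\}$ and $g=g(n):=(\beta s\ln n)^{1/2}$. For a multiset $X$ of $n$ elements (not necessarily distinct) of a totally ordered set and $1\le k\le n$, let the randomized recursive algorithm $\mathrm{Select}(X,k)$, which finds the $k$th smallest element of $X$, be as follows. 1. If $n=1$, return the only element of $X$. 2. Draw a sample $S$ of $s$ elements of $X$ uniformly at random without replacement. 3. Let $i_u:=\max\{\lceil ks/n-g\rceil,1\}$ and $i_v:=\min\{\lceil ks/n+g\rceil,s\}$. Find the $i_u$th smallest element $u$ of $S$ by calling Select recursively on $S$. If $i_u<i_v$, remove the $i_u$ smallest elements from $S$ and find the $(i_v-i_u)$th smallest element $v$ of the rest (that is, the $i_v$th smallest element of $S$) by calling Select recursively; otherwise set $v:=u$. 4. Compare the elements $x$ of $X\setminus S$ with $u$ and $v$: if $k<n/2$, $x$ is compared to $v$ first, and to $u$ only if $x<v$ and $u<v$; if $k\ge n/2$, $x$ is compared to $u$ first, and to $v$ only if $u<x$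 and $u<v$. (The outcome of a comparison is one of $<,=,>$. The positions of the elements of $S$ relative to $u$ and $v$ are known from step 3 without further comparisons, since Select also returns the positions of the elements of its input relative to the selected element.) This gives $L:=\{x\in X:x<u\}$, $U:=\{x\in X:x=u\}$, $M:=\{x\in X:u<x<v\}$, $V:=\{x\in X:x=v\}$, $R:=\{x\in X:v<x\}$. 5. If $|L|<k\le|L\cup U|$, return $u$; otherwise, if $|L\cup U\cup M|<k\le n-|R|$, return $v$. 6. Otherwise return $\mathrm{Select}(L,k)$ if $k\le|L|$, return $\mathrm{Select}(R,k-n+|R|)$ if $n-|R|<k$, and return $\mathrm{Select}(M,k-|L\cup U|)$ in the remaining case. Then there is a constant $\gamma>0$ (depending only on $\alpha$ and $\beta$) such that for every totally ordered set, every multiset $X$ of $n\ge1$ of its elements and every $1\le k\le n$, the expected number of comparisons made by $\mathrm{Select}(X,k)$, over the random choices of the algorithm, is at most $$n+\min\{k,n-k\}+\gamma\, n^{2/3}(\ln n)^{1/3}.$$ -/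

import Mathlib

open scoped ENNReal

namespace FloydRivest

universe u

/-! ### Sample size, rank gap and pivot ranks -/

/-- `f(n) = n^{2/3} (ln n)^{1/3}`. -/
noncomputable def rate (n : ℕ) : ℝ :=
  (n : ℝ) ^ (2 / 3 : ℝ) * Real.log n ^ (1 / 3 : ℝ)

/-- The sample size `s = min {⌈a f(n)⌉, n - 1}`. -/
noncomputable def sampleSize (a : ℝ) (n : ℕ) : ℕ :=
  min ⌈a * rate n⌉₊ (n - 1)

/-- The rank gap `g = (b s ln n)^{1/2}`. -/
noncomputable def gap (a b : ℝ) (n : ℕ) : ℝ :=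
  Real.sqrt (b * sampleSize a n * Real.log n)

/-- `i_u = max {⌈k s / n - g⌉, 1}`. -/
noncomputable def lowRank (a b : ℝ) (n k : ℕ) : ℕ :=
  max ⌈(k : ℝ) * sampleSize a n / n - gap a b n⌉₊ 1

/-- `i_v = min {⌈k s / n + g⌉, s}`. -/
noncomputable def highRank (a b : ℝ) (n k : ℕ) : ℕ :=
  min ⌈(k : ℝ) * sampleSize a n / n + gap a b n⌉₊ (sampleSize a n)

/-! ### Random samples -/

theorem sampleSize_le (a : ℝ) (n : ℕ) : sampleSize a n ≤ n :=
  (min_le_right _ _).trans (Nat.sub_le n 1)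

theorem powersetCard_ne_zero {T : Type u} (X : Multiset T) {s : ℕ} (h : s ≤ X.card) :
    X.powersetCard s ≠ 0 := by
  intro h0
  have h1 := Multiset.card_powersetCard s X
  rw [h0, Multiset.card_zero] at h1
  exact (Nat.choose_pos h).ne h1

/-- A sample of `s` elements drawn from the multiset `X` uniformly without replacement.
(`Multiset.powersetCard` lists every one of the `X.card.choose s` selections of `s` members of `X`,
equal members being counted separately.) -/
noncomputable def uniformSample {T : Type u} (X : Multiset T) (s : ℕ) (h : s ≤ X.card) :
    PMF (Multiset T) :=
  PMF.ofMultiset (X.powersetCard s) (powersetCard_ne_zero X h)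

/-! ### The algorithm

Every run of a routine returns a pair: its result and the number of (three-way) comparisons of
elements that it has made. -/

/-- The result of selecting the `k`th smallest element `pivot` of a multiset: this element, and the
positions of all elements of the multiset relative to it, which are known when it is found. -/
structure Selection (T : Type u) where
  pivot : T
  lt : Multiset T
  eq : Multiset T
  gt : Multiset T

/-- Two pivots `u ≤ v` and a multiset partitioned by them into the elements `x < u`, `x = u`,
`u < x < v`, `x = v`, `v < x`. If `u = v`, then the elements equal to it are in `U`, and `M` and `V`
are empty. -/
structure Partition (T : Type u) where
  u : T
  v : T
  L : Multiset T
  U : Multiset T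
  M : Multiset T
  V : Multiset T
  R : Multiset T

/-- How many copies of the pivot are left when the `i` smallest elements are removed from the
multiset that `r` describes, where `i` is a rank of the pivot. -/
def copiesLeft {T : Type u} (r : Selection T) (i : ℕ) : ℕ :=
  r.lt.card + r.eq.card - i

/-- The multiset that `r` describes without its `i` smallest elements, where `i` is a rank of the
pivot. -/
def dropSmallest {T : Type u} (r : Selection T) (i : ℕ) : Multiset T :=
  Multiset.replicate (copiesLeft r i) r.pivot + r.gt

/-- The partition of the sample by a single pivot `u = v`. -/
def singlePivot {T : Type u} (r : Selection T) : Partition T :=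
  ⟨r.pivot, r.pivot, r.lt, r.eq, 0, 0, r.gt⟩

/-- The partition of the sample by both pivots; `ru` describes the sample relative to `u`, and `rv`
describes the sample without its `i` smallest elements relative to `v`. The case `u < v` is known
without a further comparison: it occurs iff the rank of `v` in the sample exceeds
`ru.lt.card + ru.eq.card`. -/
def twoPivots {T : Type u} [LinearOrder T] (ru rv : Selection T) (i : ℕ) : Partition T :=
  if ru.pivot < rv.pivot then
    ⟨ru.pivot, rv.pivot, ru.lt, ru.eq,
      rv.lt - Multiset.replicate (copiesLeft ru i) ru.pivot, rv.eq, rv.gt⟩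
  else singlePivot ru

/-- Pivot selection: find the `iu`th smallest element `u` of the sample `S` with the routine `sel`;
if `iu < iv`, remove the `iu` smallest elements from `S` and find the `(iv - iu)`th smallest element
`v` of the rest, which is the `iv`th smallest element of `S`; otherwise `v = u`. -/
noncomputable def selectPivots {T : Type u} [LinearOrder T]
    (sel : Multiset T → ℕ → PMF (Selection T × ℕ∞))
    (S : Multiset T) (iu iv : ℕ) : PMF (Partition T × ℕ∞) :=
  (sel S iu).bind fun ru =>
    if iu < iv then
      (sel (dropSmallest ru.1 iu) (iv - iu)).bind fun rv =>
        PMF.pure (twoPivots ru.1 rv.1 iu, ru.2 + rv.2)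
    else PMF.pure (singlePivot ru.1, ru.2)

/-- The number of comparisons of `x` with the pivots. If `k < n / 2`, then `x` is compared to `v`
first, and to `u` only if `x < v` and `u < v`; if `k ≥ n / 2`, then `x` is compared to `u` first, and
to `v` only if `u < x` and `u < v`. -/
def comparisonsFor {T : Type u} [LinearOrder T] (n k : ℕ) (u v x : T) : ℕ :=
  if 2 * k < n then
    1 + (if x < v ∧ u < v then 1 else 0)
  else
    1 + (if u < x ∧ u < v then 1 else 0)

/-- The number of comparisons of the elements of `Y` with the pivots. -/
def partitionCost {T : Type u} [LinearOrder T] (n k : ℕ) (u v : T) (Y : Multiset T) : ℕ :=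
  (Y.map (comparisonsFor n k u v)).sum

/-- Extend the partition `p` of the sample by the elements of `Y`, the rest of the input. -/
def extendPartition {T : Type u} [LinearOrder T] (p : Partition T) (Y : Multiset T) : Partition T where
  u := p.u
  v := p.v
  L := p.L + Y.filter fun x => x < p.u
  U := p.U + Y.filter fun x => x = p.u
  M := p.M + Y.filter fun x => p.u < x ∧ x < p.v
  V := p.V + Y.filter fun x => x = p.v ∧ p.u < p.v
  R := p.R + Y.filter fun x => p.v < x

/-- The stopping test, the reduction and the final recursive call of `sel`, for the `k`th smallest
element of a multiset of `n` elements with partition `q`. -/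
noncomputable def finish {T : Type u} (sel : Multiset T → ℕ → PMF (Selection T × ℕ∞))
    (n k : ℕ) (q : Partition T) : PMF (Selection T × ℕ∞) :=
  if q.L.card < k ∧ k ≤ (q.L + q.U).card then
    PMF.pure (⟨q.u, q.L, q.U, q.M + q.V + q.R⟩, 0)
  else if (q.L + q.U + q.M).card < k ∧ k ≤ n - q.R.card then
    PMF.pure (⟨q.v, q.L + q.U + q.M, q.V, q.R⟩, 0)
  else if k ≤ q.L.card then
    (sel q.L k).map fun r =>
      (⟨r.1.pivot, r.1.lt, r.1.eq, r.1.gt + q.U + q.M + q.V + q.R⟩, r.2)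
  else if n - q.R.card < k then
    (sel q.R (k + q.R.card - n)).map fun r =>
      (⟨r.1.pivot, q.L + q.U + q.M + q.V + r.1.lt, r.1.eq, r.1.gt⟩, r.2)
  else
    (sel q.M (k - (q.L + q.U).card)).map fun r =>
      (⟨r.1.pivot, q.L + q.U + r.1.lt, r.1.eq, r.1.gt + q.V + q.R⟩, r.2)

/-- The body of `Select`, with the routine `sel` for its recursive calls. Only the elements outside
the sample are compared with the pivots: the positions of the others are known. -/
noncomputable def selectStep {T : Type u} [LinearOrder T] (a b : ℝ)
    (sel : Multiset T → ℕ → PMF (Selection T × ℕ∞))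
    (X : Multiset T) (k : ℕ) : PMF (Selection T × ℕ∞) :=
  if h : X.card = 1 then
    PMF.pure (⟨(Multiset.card_eq_one.mp h).choose, 0, X, 0⟩, 0)
  else
    (uniformSample X (sampleSize a X.card) (sampleSize_le a X.card)).bind fun S =>
      (selectPivots sel S (lowRank a b X.card k) (highRank a b X.card k)).bind fun p =>
        (finish sel X.card k (extendPartition p.1 (X - S))).map fun r =>
          (r.1, p.2 + (partitionCost X.card k p.1.u p.1.v (X - S) : ℕ) + r.2)

/-- `Select` with at most `d` nested levels of calls. A run that would need more of them is charged
`∞` comparisons, so that an upper bound on the cost includes that this does not happen. -/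
noncomputable def selectAux {T : Type u} [LinearOrder T] [Nonempty T]
    (a b : ℝ) : ℕ → Multiset T → ℕ → PMF (Selection T × ℕ∞)
  | 0 => fun _ _ => PMF.pure (⟨Classical.arbitrary T, 0, 0, 0⟩, ⊤)
  | d + 1 => selectStep a b (selectAux a b d)

/-- The randomized algorithm `Select (X, k)`. Each recursive call is on a multiset with fewer
elements, so that `X.card` nested levels are enough. -/
noncomputable def select {T : Type u} [LinearOrder T] [Nonempty T]
    (a b : ℝ) (X : Multiset T) (k : ℕ) : PMF (Selection T × ℕ∞) :=
  selectAux a b X.card X k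

/-- The expected number of comparisons made by `Select (X, k)`. -/
noncomputable def expectedComparisons {T : Type u} [LinearOrder T] [Nonempty T]
    (a b : ℝ) (X : Multiset T) (k : ℕ) : ℝ≥0∞ :=
  ∑' r : Selection T × ℕ∞, select a b X k r * (r.2 : ℝ≥0∞)

end FloydRivest

/-!
Two facts carry the proof: `Select` is correct, and the two pivots almost always enclose the `k`th
smallest element within a narrow range of ranks.

*The sample.* List the input in increasing order, so that a sample is a uniformly random set of `s`
of the `n` positions. For a set `A` of positions, the number of sampled positions in `A` is
hypergeometric with mean `|A| s / n`. It falls short of the mean by `g` with probability at most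
`exp (-2 g² / s)` (`card_filter_card_inter_le`): the moment generating function is at most that of
a binomial variable, since this holds for the factorial moments (`choose_mul_choose_le`), and
Hoeffding's lemma bounds the latter. With `g² = b s ln n` the probability is `n ^ (-2 b)`.

*The pivots.* Let `D ≥ 2 g n / s`. If the sample is not deficient by `g` in any of four sets of
lowest or highest positions (`Unbalanced`), then the rank conditions on `u` and `v` force the
following: fewer than `k + D` elements are below `v` and fewer than `n - k + D` are above `u`; at
most `2 D` lie strictly between the pivots; and the elements below `u` or above `v` are fewer than
`D` if the final call is made on them. The truncations of the pivot ranks at `1` and `s` cost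
nothing, because the four sets have at least `D` elements. Hence at most `min {k, n - k} + D`
elements are compared with both pivots, and the final call is on at most `2 D` elements.

*The recurrence.* Let `H m = 2 m + γ f m` bound the cost of the recursive calls. Then
(`expectedCost_selectStep_le`) the expected cost is at most
`n + min {k, n - k} + D + 2 H (s) + H (2 D) + 4 n ^ (-2 b) (n + H n)`.
Here `s` and `D` are `O (f n)`, and `n ^ (1 - 2 b) ≤ n ^ (2/3) ≤ f n`; this is where `1/6 ≤ b`
enters. Moreover `f (O (f n)) = o (f n)`, as `f m / f n ≤ (m / n) ^ (2/3)` for `m ≤ n`. So the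
terms without `γ` add up to at most `C f n`, those with `γ` to at most `γ f n / 2` for large `n`
(`eventually_recurrence`), and any `γ ≥ 2 C` closes the induction. For the remaining finitely many
`n` the crude bound `4 ^ n` (`selectAux_correct_and_crude`) is absorbed by enlarging `γ`.
-/

namespace FloydRivest

universe u

/-! ### Tails of the hypergeometric distribution -/

/-- The number of `s`-element subsets that include a given set. -/
theorem card_filter_powersetCard_superset {ι : Type*} [Fintype ι] [DecidableEq ι] (s : ℕ)
    (U : Finset ι) (hU : U.card ≤ s) :
    (((Finset.univ : Finset ι).powersetCard s).filter (U ⊆ ·)).card =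
      (Fintype.card ι - U.card).choose (s - U.card) := by
  rw [← Finset.card_compl, ← Finset.card_powersetCard]
  refine Finset.card_bij' (fun t _ => t \ U) (fun t _ => t ∪ U) ?_ ?_ ?_ ?_
  · intro t ht
    simp only [Finset.mem_filter, Finset.mem_powersetCard_univ] at ht
    rw [Finset.mem_powersetCard, Finset.card_sdiff_of_subset ht.2, ht.1]
    exact ⟨fun x hx => by simp at hx ⊢; exact hx.2, rfl⟩
  · intro t ht
    rw [Finset.mem_powersetCard] at ht
    have hd : Disjoint t U := Finset.disjoint_left.2 fun x hx => by simpa using ht.1 hx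
    simp only [Finset.mem_filter, Finset.mem_powersetCard_univ, Finset.card_union_of_disjoint hd,
      ht.2, Finset.subset_union_right, and_true]
    omega
  · intro t ht
    simp only [Finset.mem_filter] at ht
    exact Finset.sdiff_union_of_subset ht.2
  · intro t ht
    rw [Finset.mem_powersetCard] at ht
    have hd : Disjoint t U := Finset.disjoint_left.2 fun x hx => by simpa using ht.1 hx
    rw [Finset.union_sdiff_right]
    exact Finset.sdiff_eq_self_of_disjoint hd

/-- The factorial moments of the hypergeometric distribution, by double counting of the pairs
`U ⊆ t` with `U` an `i`-element subset of `B`. -/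
theorem sum_choose_card_inter {ι : Type*} [Fintype ι] [DecidableEq ι] {s i : ℕ} (hi : i ≤ s)
    (B : Finset ι) :
    ∑ t ∈ (Finset.univ : Finset ι).powersetCard s, (t ∩ B).card.choose i =
      B.card.choose i * (Fintype.card ι - i).choose (s - i) := by
  have h1 (t : Finset ι) : (t ∩ B).card.choose i =
      ∑ U ∈ B.powersetCard i, if U ⊆ t then 1 else 0 := by
    rw [← Finset.card_powersetCard, Finset.sum_boole]
    congr 1
    ext U
    simp only [Finset.mem_powersetCard, Finset.mem_filter, Finset.subset_inter_iff]
    tauto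
  simp_rw [h1]
  rw [Finset.sum_comm, ← Finset.card_powersetCard i B, ← smul_eq_mul, ← Finset.sum_const]
  refine Finset.sum_congr rfl fun U hU => ?_
  have hc := (Finset.mem_powersetCard.1 hU).2
  rw [Finset.sum_boole, ← hc, ← card_filter_powersetCard_superset s U (hc.le.trans hi), Nat.cast_id]

theorem descFactorial_mul_pow_le {m n : ℕ} (h : m ≤ n) (i : ℕ) :
    m.descFactorial i * n ^ i ≤ n.descFactorial i * m ^ i := by
  induction i with
  | zero => simp
  | succ i ih =>
    rw [Nat.descFactorial_succ, Nat.descFactorial_succ]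
    have h2 : (m - i) * n ≤ (n - i) * m := by
      rw [Nat.sub_mul, Nat.sub_mul, mul_comm n m]
      exact Nat.sub_le_sub_left (Nat.mul_le_mul_left i h) _
    calc _ = ((m - i) * n) * (m.descFactorial i * n ^ i) := by ring
      _ ≤ ((n - i) * m) * (n.descFactorial i * m ^ i) := Nat.mul_le_mul h2 ih
      _ = _ := by ring

/-- The factorial moments of the hypergeometric distribution are at most those of the binomial
distribution with the same mean. -/
theorem choose_mul_choose_le {m n s i : ℕ} (h : m ≤ n) (hi : i ≤ s) (hn : 0 < n) :
    ((m.choose i * (n - i).choose (s - i) : ℕ) : ℝ) ≤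
      n.choose s * (s.choose i * ((m : ℝ) / n) ^ i) := by
  have h1 : n.choose s * s.choose i = n.choose i * (n - i).choose (s - i) := Nat.choose_mul hi
  have h2 : (m.choose i : ℝ) ≤ n.choose i * ((m : ℝ) / n) ^ i := by
    have h3 := descFactorial_mul_pow_le h i
    rw [Nat.descFactorial_eq_factorial_mul_choose, Nat.descFactorial_eq_factorial_mul_choose,
      mul_assoc, mul_assoc] at h3
    have h4 : (m.choose i * n ^ i : ℝ) ≤ n.choose i * m ^ i := by
      exact_mod_cast Nat.le_of_mul_le_mul_left h3 (Nat.factorial_pos i)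
    rw [div_pow, ← mul_div_assoc, le_div_iff₀ (by positivity)]
    exact h4
  calc ((m.choose i * (n - i).choose (s - i) : ℕ) : ℝ)
      ≤ n.choose i * ((m : ℝ) / n) ^ i * (n - i).choose (s - i) := by push_cast; gcongr
    _ = (n.choose i * (n - i).choose (s - i) : ℕ) * ((m : ℝ) / n) ^ i := by push_cast; ring
    _ = _ := by rw [← h1]; push_cast; ring

/-- The moment generating function of the hypergeometric distribution, at `exp l = 1 + y`, is at
most that of the binomial distribution with the same mean. -/
theorem sum_one_add_pow_card_inter_le {ι : Type*} [Fintype ι] [DecidableEq ι] (s : ℕ)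
    (hn : 0 < Fintype.card ι) (B : Finset ι) {y : ℝ} (hy : 0 ≤ y) :
    ∑ t ∈ (Finset.univ : Finset ι).powersetCard s, (1 + y) ^ (t ∩ B).card ≤
      (Fintype.card ι).choose s * (1 + (B.card : ℝ) / Fintype.card ι * y) ^ s := by
  have h1 : ∀ t ∈ (Finset.univ : Finset ι).powersetCard s, (1 + y) ^ (t ∩ B).card =
      ∑ i ∈ Finset.range (s + 1), ((t ∩ B).card.choose i : ℝ) * y ^ i := by
    intro t ht
    have hc : (t ∩ B).card ≤ s :=
      (Finset.card_le_card Finset.inter_subset_left).trans (Finset.mem_powersetCard_univ.1 ht).le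
    rw [add_comm, add_pow]
    simp only [one_pow, mul_one]
    rw [← Finset.sum_subset (Finset.range_mono (Nat.succ_le_succ hc))]
    · exact Finset.sum_congr rfl fun i _ => mul_comm _ _
    · intro i _ hi
      rw [Finset.mem_range, not_lt] at hi
      rw [Nat.choose_eq_zero_of_lt (by omega)]
      simp
  rw [Finset.sum_congr rfl h1, Finset.sum_comm, add_comm (1 : ℝ), add_pow, Finset.mul_sum]
  refine Finset.sum_le_sum fun i hi => ?_
  have his : i ≤ s := Nat.lt_succ_iff.1 (Finset.mem_range.1 hi)
  rw [← Finset.sum_mul, ← Nat.cast_sum, sum_choose_card_inter his]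
  have := choose_mul_choose_le (Finset.card_le_univ B) his hn
  calc _ ≤ (Fintype.card ι).choose s * (s.choose i * ((B.card : ℝ) / Fintype.card ι) ^ i) *
          y ^ i := by
        gcongr
    _ = _ := by rw [mul_pow, one_pow]; ring

open MeasureTheory ProbabilityTheory in
/-- Hoeffding's lemma for a Bernoulli variable of mean `p`. -/
theorem bernoulli_mgf_le {p : ℝ} (h0 : 0 ≤ p) (h1 : p ≤ 1) (l : ℝ) :
    1 + p * (Real.exp l - 1) ≤ Real.exp (p * l + l ^ 2 / 8) := by
  lift p to unitInterval using ⟨h0, h1⟩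
  have hX : ∀ᵐ x ∂(bernoulliMeasure (1 : ℝ) 0 p), id x ∈ Set.Icc (0 : ℝ) 1 := by
    rw [bernoulliMeasure_def]
    rw [ae_add_measure_iff]
    exact ⟨Measure.ae_smul_measure (by simp) _, Measure.ae_smul_measure (by simp) _⟩
  have h := (hasSubgaussianMGF_of_mem_Icc measurable_id.aemeasurable hX).mgf_le l
  rw [mgf, integral_bernoulliMeasure, integral_bernoulliMeasure] at h
  simp only [id, smul_eq_mul, mul_one, mul_zero, add_zero] at h
  have h2 : Real.exp (l * (1 - p)) = Real.exp l * Real.exp (-(p * l)) := by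
    rw [← Real.exp_add]; congr 1; ring
  have h3 : Real.exp (l * (0 - p)) = Real.exp (-(p * l)) := by congr 1; ring
  have h4 : (((‖(1 : ℝ) - 0‖₊ / 2) ^ 2 : NNReal) : ℝ) * l ^ 2 / 2 = l ^ 2 / 8 := by
    simp; ring
  rw [h2, h3, h4] at h
  rw [Real.exp_add, ← div_le_iff₀' (Real.exp_pos _), div_eq_mul_inv, ← Real.exp_neg]
  refine le_trans (le_of_eq ?_) h
  ring

/-- The lower tail of the hypergeometric distribution: in at most the fraction `exp (-2 g ^ 2 / s)`
of the `s`-element subsets, the number of elements of `A` falls short of its mean by `g`. -/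
theorem card_filter_card_inter_le {ι : Type*} [Fintype ι] [DecidableEq ι] {s : ℕ}
    (hs : s ≤ Fintype.card ι) (hs0 : 0 < s) (A : Finset ι) {g : ℝ} (hg : 0 ≤ g) :
    ((((Finset.univ : Finset ι).powersetCard s).filter fun t =>
      ((t ∩ A).card : ℝ) ≤ A.card * s / Fintype.card ι - g).card : ℝ) ≤
      (Fintype.card ι).choose s * Real.exp (-2 * g ^ 2 / s) := by
  have hn : 0 < Fintype.card ι := hs0.trans_le hs
  set n := Fintype.card ι with hn'
  have hn0 : (0 : ℝ) < n := by exact_mod_cast hn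
  have hs1 : (0 : ℝ) < s := by exact_mod_cast hs0
  set p : ℝ := (Aᶜ.card : ℝ) / n with hp
  have hAc : (Aᶜ.card : ℝ) = n - A.card := by
    rw [Finset.card_compl, Nat.cast_sub (Finset.card_le_univ A)]
  have hp1 : p ≤ 1 := by
    rw [hp, div_le_one hn0, hAc]
    have : (0 : ℝ) ≤ A.card := by positivity
    linarith
  -- this minimizes `-l * g + s * l ^ 2 / 8`
  set l : ℝ := 4 * g / s with hl
  have hl0 : 0 ≤ l := by positivity
  have hpos : 0 < Real.exp (l * (p * s + g)) := Real.exp_pos _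
  -- Markov's inequality for the number of sampled elements outside `A`, which is large when the
  -- number of those in `A` is small; only positive exponents are available for the comparison
  -- with the binomial distribution
  have key : ((((Finset.univ : Finset ι).powersetCard s).filter fun t =>
      ((t ∩ A).card : ℝ) ≤ A.card * s / n - g).card : ℝ) * Real.exp (l * (p * s + g)) ≤
      n.choose s * (Real.exp (p * l + l ^ 2 / 8)) ^ s := by
    rw [← nsmul_eq_mul, ← Finset.sum_const]
    calc _ ≤ ∑ t ∈ ((Finset.univ : Finset ι).powersetCard s).filter fun t =>
          ((t ∩ A).card : ℝ) ≤ A.card * s / n - g, (1 + (Real.exp l - 1)) ^ (t ∩ Aᶜ).card := by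
          refine Finset.sum_le_sum fun t ht => ?_
          rw [Finset.mem_filter, Finset.mem_powersetCard_univ] at ht
          have hc : ((t ∩ A).card : ℝ) + (t ∩ Aᶜ).card = s := by
            rw [← ht.1, ← Finset.sdiff_eq_inter_compl]
            exact_mod_cast Finset.card_inter_add_card_sdiff t A
          rw [add_sub_cancel, ← Real.exp_nat_mul, Real.exp_le_exp, mul_comm]
          refine mul_le_mul_of_nonneg_right ?_ hl0
          have : p * s = s - A.card * s / n := by
            rw [hp, hAc]; field_simp
          linarith [ht.2]
      _ ≤ ∑ t ∈ (Finset.univ : Finset ι).powersetCard s, (1 + (Real.exp l - 1)) ^ (t ∩ Aᶜ).card := by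
          refine Finset.sum_le_sum_of_subset_of_nonneg (Finset.filter_subset _ _) fun t _ _ => ?_
          rw [add_sub_cancel]; positivity
      _ ≤ n.choose s * (1 + p * (Real.exp l - 1)) ^ s :=
          sum_one_add_pow_card_inter_le s hn Aᶜ (by linarith [Real.one_le_exp hl0])
      _ ≤ _ := by
          have : 0 ≤ p * (Real.exp l - 1) :=
            mul_nonneg (by positivity) (by linarith [Real.one_le_exp hl0])
          gcongr
          exact bernoulli_mgf_le (by positivity) hp1 l
  rw [← le_div_iff₀ hpos] at key
  refine key.trans_eq ?_
  rw [mul_div_assoc, ← Real.exp_nat_mul, ← Real.exp_sub]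
  congr 2
  rw [hl]; field_simp; ring

/-! ### Expectations and random samples -/

/-- The expectation of an extended nonnegative function of a random outcome. -/
noncomputable def expect {α : Type*} (p : PMF α) (f : α → ℝ≥0∞) : ℝ≥0∞ := ∑' x, p x * f x

section Expectation

variable {α β : Type*}

theorem expect_bind (p : PMF α) (q : α → PMF β) (f : β → ℝ≥0∞) :
    expect (p.bind q) f = expect p fun x => expect (q x) f := by
  simp only [expect, PMF.bind_apply, ← ENNReal.tsum_mul_left, ← ENNReal.tsum_mul_right]
  rw [ENNReal.tsum_comm]
  simp only [mul_assoc]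

theorem expect_pure (x : α) (f : α → ℝ≥0∞) : expect (PMF.pure x) f = f x := by
  rw [expect, tsum_eq_single x fun y hy => by rw [PMF.pure_apply_of_ne _ _ hy, zero_mul],
    PMF.pure_apply_self, one_mul]

theorem expect_map (p : PMF α) (g : α → β) (f : β → ℝ≥0∞) :
    expect (p.map g) f = expect p fun x => f (g x) := by
  rw [← PMF.bind_pure_comp, expect_bind]
  simp only [Function.comp_apply, expect_pure]

theorem expect_mono {p : PMF α} {f g : α → ℝ≥0∞} (h : ∀ x ∈ p.support, f x ≤ g x) :
    expect p f ≤ expect p g := by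
  refine ENNReal.tsum_le_tsum fun x => ?_
  by_cases hx : p x = 0
  · simp [hx]
  · exact mul_le_mul_right (h x ((PMF.mem_support_iff p x).2 hx)) _

theorem expect_add (p : PMF α) (f g : α → ℝ≥0∞) :
    expect p (fun x => f x + g x) = expect p f + expect p g := by
  simp only [expect, mul_add, ENNReal.tsum_add]

theorem expect_const (p : PMF α) (c : ℝ≥0∞) : expect p (fun _ => c) = c := by
  simp only [expect, ENNReal.tsum_mul_right, PMF.tsum_coe, one_mul]

theorem expect_le {p : PMF α} {f : α → ℝ≥0∞} {c : ℝ≥0∞} (h : ∀ x ∈ p.support, f x ≤ c) :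
    expect p f ≤ c :=
  (expect_mono h).trans_eq (expect_const p c)

theorem expect_ofMultiset (s : Multiset α) (hs : s ≠ 0) (f : α → ℝ≥0∞) :
    expect (PMF.ofMultiset s hs) f = (s.map f).sum / s.card := by
  classical
  have h1 : ∀ x, PMF.ofMultiset s hs x * f x = (s.count x • f x) * (s.card : ℝ≥0∞)⁻¹ := by
    intro x
    rw [PMF.ofMultiset_apply, nsmul_eq_mul, div_eq_mul_inv]
    ring
  rw [expect, tsum_congr h1, ENNReal.tsum_mul_right, Finset.sum_multiset_map_count, div_eq_mul_inv,
    tsum_eq_sum (s := s.toFinset)]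
  intro x hx
  rw [Multiset.count_eq_zero_of_notMem (by simpa using hx), zero_smul]

end Expectation

section Sampling

variable {T : Type u}

/-- A uniform sample of a listed multiset is the image of a uniformly random set of positions. -/
theorem expect_uniformSample_map {n : ℕ} (x : Fin n → T) (s : ℕ)
    (h : s ≤ (Finset.univ.val.map x).card) (f : Multiset T → ℝ≥0∞) :
    expect (uniformSample (Finset.univ.val.map x) s h) f =
      (∑ t ∈ (Finset.univ : Finset (Fin n)).powersetCard s, f (t.val.map x)) / (n.choose s : ℕ) := by
  rw [uniformSample, expect_ofMultiset, Multiset.card_powersetCard, Multiset.card_map,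
    Multiset.powersetCard_map, Multiset.map_map, ← Finset.map_val_val_powersetCard, Multiset.map_map,
    Finset.card_val, Finset.card_univ, Fintype.card_fin]
  rfl

theorem mem_support_uniformSample {X S : Multiset T} {s : ℕ} {h : s ≤ X.card}
    (hS : S ∈ (uniformSample X s h).support) : S ≤ X ∧ S.card = s := by
  rw [uniformSample, PMF.mem_support_ofMultiset_iff] at hS
  simpa only [Multiset.mem_toFinset, Multiset.mem_powersetCard] using hS

/-- A multiset listed in increasing order. Positions in the list tell equal elements apart, so that
samples become sets of positions. -/
theorem exists_monotone_map_eq [LinearOrder T] (X : Multiset T) :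
    ∃ x : Fin X.card → T, Monotone x ∧ Finset.univ.val.map x = X := by
  obtain ⟨l, hl, hs⟩ : ∃ l : List T, (l : Multiset T) = X ∧ l.SortedLE :=
    ⟨X.sort, X.sort_eq _, (X.pairwise_sort _).sortedLE⟩
  subst hl
  refine ⟨l.get, hs.monotone_get, ?_⟩
  change (Finset.univ : Finset (Fin l.length)).val.map l.get = l
  rw [Fin.univ_val_map, List.ofFn_get]

end Sampling

/-! ### Correctness of pivot selection, partition and reduction -/

section Correctness

variable {T : Type u} [LinearOrder T]

/-- `w` is the `k`th smallest element of `X`, copies counted separately: fewer than `k` elements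
are smaller than `w`, and at least `k` are at most `w`. -/
def IsRank (X : Multiset T) (k : ℕ) (w : T) : Prop :=
  (X.filter (· < w)).card < k ∧ k ≤ (X.filter (· ≤ w)).card

/-- `r` is a correct answer to the task of selecting the `k`th smallest element of `X`. -/
structure IsSelection (X : Multiset T) (k : ℕ) (r : Selection T) : Prop where
  lt : r.lt = X.filter (· < r.pivot)
  eq : r.eq = X.filter (· = r.pivot)
  gt : r.gt = X.filter (r.pivot < ·)
  card_lt : r.lt.card < k
  le_card : k ≤ r.lt.card + r.eq.card

/-- `p` is the partition of `X` by the pivots `p.u ≤ p.v`. -/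
structure IsPartition (X : Multiset T) (p : Partition T) : Prop where
  le : p.u ≤ p.v
  L : p.L = X.filter (· < p.u)
  U : p.U = X.filter (· = p.u)
  M : p.M = X.filter fun x => p.u < x ∧ x < p.v
  V : p.V = X.filter fun x => x = p.v ∧ p.u < p.v
  R : p.R = X.filter (p.v < ·)

theorem filter_lt_add_filter_eq (X : Multiset T) (w : T) :
    X.filter (· < w) + X.filter (· = w) = X.filter (· ≤ w) := by
  ext a; simp only [Multiset.count_add, Multiset.count_filter]; grind

theorem filter_le_add_filter_gt (X : Multiset T) (w : T) :
    X.filter (· ≤ w) + X.filter (w < ·) = X := by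
  ext a; simp only [Multiset.count_add, Multiset.count_filter]; grind

namespace IsSelection

variable {X : Multiset T} {k : ℕ} {r : Selection T}

theorem lt_add_eq (h : IsSelection X k r) : r.lt + r.eq = X.filter (· ≤ r.pivot) := by
  rw [h.lt, h.eq, filter_lt_add_filter_eq]

theorem isRank (h : IsSelection X k r) : IsRank X k r.pivot :=
  ⟨h.lt ▸ h.card_lt, by rw [← h.lt_add_eq, Multiset.card_add]; exact h.le_card⟩

theorem pivot_mem (h : IsSelection X k r) : r.pivot ∈ X := by
  have h1 : 0 < r.eq.card := by have := h.card_lt; have := h.le_card; omega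
  obtain ⟨x, hx⟩ := Multiset.card_pos_iff_exists_mem.1 h1
  rw [h.eq, Multiset.mem_filter] at hx
  exact hx.2 ▸ hx.1

theorem card_dropSmallest (h : IsSelection X k r) : (dropSmallest r k).card = X.card - k := by
  have h1 := congrArg Multiset.card (filter_le_add_filter_gt X r.pivot)
  rw [← h.lt_add_eq, ← h.gt, Multiset.card_add, Multiset.card_add] at h1
  rw [dropSmallest, copiesLeft, Multiset.card_add, Multiset.card_replicate]
  have := h.le_card
  omega

end IsSelection

theorem isPartition_singlePivot {S : Multiset T} {i : ℕ} {r : Selection T}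
    (h : IsSelection S i r) : IsPartition S (singlePivot r) where
  le := le_rfl
  L := h.lt
  U := h.eq
  M := by
    refine (Multiset.filter_eq_nil.2 fun x _ hx => ?_).symm
    exact lt_irrefl _ (hx.1.trans hx.2)
  V := by
    refine (Multiset.filter_eq_nil.2 fun x _ hx => ?_).symm
    exact lt_irrefl _ hx.2
  R := h.gt

/-- The second pivot is at least the first, and it has rank `j` in the whole sample. -/
theorem pivot_le_and_isRank {S : Multiset T} {i j : ℕ} (hij : i < j) {ru rv : Selection T}
    (hu : IsSelection S i ru) (hv : IsSelection (dropSmallest ru i) (j - i) rv) :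
    ru.pivot ≤ rv.pivot ∧ IsRank S j rv.pivot := by
  have hle : ru.pivot ≤ rv.pivot := by
    have h1 := hv.pivot_mem
    rw [dropSmallest, Multiset.mem_add, hu.gt, Multiset.mem_filter] at h1
    rcases h1 with h1 | h1
    · exact (Multiset.eq_of_mem_replicate h1).ge
    · exact h1.2.le
  refine ⟨hle, ?_⟩
  have hr := hv.isRank
  have h1 := hu.le_card
  have h2 := hu.card_lt
  have h3 := congrArg Multiset.card hu.lt_add_eq
  rw [Multiset.card_add] at h3
  have hc : copiesLeft ru i + i = ru.lt.card + ru.eq.card := by unfold copiesLeft; omega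
  have hd (p : T → Prop) [DecidablePred p] : ((dropSmallest ru i).filter p).card =
      (if p ru.pivot then copiesLeft ru i else 0) +
        (S.filter fun x => p x ∧ ru.pivot < x).card := by
    rw [dropSmallest, hu.gt, Multiset.filter_add, Multiset.card_add, Multiset.filter_filter]
    congr 1
    split_ifs with hp
    · rw [Multiset.filter_eq_self.2, Multiset.card_replicate]
      intro a ha; rwa [Multiset.eq_of_mem_replicate ha]
    · rw [Multiset.card_eq_zero, Multiset.filter_eq_nil]
      intro a ha; rwa [Multiset.eq_of_mem_replicate ha]
  have hs (p : T → Prop) [DecidablePred p] (hp : ∀ x ≤ ru.pivot, p x) :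
      (S.filter p).card = (S.filter (· ≤ ru.pivot)).card +
        (S.filter fun x => p x ∧ ru.pivot < x).card := by
    rw [← Multiset.card_add]
    congr 1
    ext a; simp only [Multiset.count_add, Multiset.count_filter]; grind
  rw [IsRank, hd, hd, if_pos hle] at hr
  have h4 := hs (· ≤ rv.pivot) fun x hx => hx.trans hle
  refine ⟨?_, by omega⟩
  rcases hle.lt_or_eq with hlt | heq
  · rw [if_pos hlt] at hr
    have h5 := hs (· < rv.pivot) fun x hx => hx.trans_lt hlt
    omega
  · rw [← heq, ← hu.lt]
    omega

/-- The elements that are not among the `i` smallest include the surplus copies of the first pivot,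
which `twoPivots` removes from those below the second pivot. -/
theorem isPartition_twoPivots {S : Multiset T} {i j : ℕ} {ru rv : Selection T}
    (hu : IsSelection S i ru) (hv : IsSelection (dropSmallest ru i) j rv) :
    IsPartition S (twoPivots ru rv i) := by
  unfold twoPivots
  split_ifs with huv
  · refine ⟨huv.le, hu.lt, hu.eq, ?_, ?_, ?_⟩
    · change rv.lt - Multiset.replicate (copiesLeft ru i) ru.pivot = _
      rw [hv.lt, dropSmallest, Multiset.filter_add, Multiset.filter_eq_self.2, add_tsub_cancel_left,
        hu.gt, Multiset.filter_filter]
      · simp only [and_comm]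
      · intro a ha; rwa [Multiset.eq_of_mem_replicate ha]
    · change rv.eq = _
      rw [hv.eq, dropSmallest, Multiset.filter_add, Multiset.filter_eq_nil.2, zero_add,
        hu.gt, Multiset.filter_filter]
      · refine Multiset.filter_congr fun x _ => ?_
        change x = rv.pivot ∧ _ ↔ x = rv.pivot ∧ _
        refine and_congr_right fun h => ?_
        rw [h]
      · intro a ha; rw [Multiset.eq_of_mem_replicate ha]; exact huv.ne
    · change rv.gt = _
      rw [hv.gt, dropSmallest, Multiset.filter_add, Multiset.filter_eq_nil.2, zero_add,
        hu.gt, Multiset.filter_filter]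
      · refine Multiset.filter_congr fun x _ => ?_
        exact ⟨fun h => h.1, fun h => ⟨h, huv.trans h⟩⟩
      · intro a ha; rw [Multiset.eq_of_mem_replicate ha]; exact huv.not_gt
  · exact isPartition_singlePivot hu

theorem isPartition_extendPartition {S X : Multiset T} (h : S ≤ X) {p : Partition T}
    (hp : IsPartition S p) : IsPartition X (extendPartition p (X - S)) := by
  have hf (q : T → Prop) [DecidablePred q] :
      S.filter q + (X - S).filter q = X.filter q := by
    rw [← Multiset.filter_add, add_tsub_cancel_of_le h]
  refine ⟨hp.le, ?_, ?_, ?_, ?_, ?_⟩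
  · rw [← hf, extendPartition, hp.L]
  · rw [← hf, extendPartition, hp.U]
  · rw [← hf, extendPartition, hp.M]
  · rw [← hf, extendPartition, hp.V]
  · rw [← hf, extendPartition, hp.R]

namespace IsPartition

variable {X : Multiset T} {q : Partition T}

theorem L_add_U (h : IsPartition X q) : q.L + q.U = X.filter (· ≤ q.u) := by
  rw [h.L, h.U, filter_lt_add_filter_eq]

theorem M_add_V_add_R (h : IsPartition X q) : q.M + q.V + q.R = X.filter (q.u < ·) := by
  have := h.le
  rw [h.M, h.V, h.R]
  ext a; simp only [Multiset.count_add, Multiset.count_filter]; grind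

theorem L_add_U_add_M (h : IsPartition X q) (huv : q.u < q.v) :
    q.L + q.U + q.M = X.filter (· < q.v) := by
  rw [h.L_add_U, h.M]
  ext a; simp only [Multiset.count_add, Multiset.count_filter]; grind

theorem L_add_U_add_M_add_V (h : IsPartition X q) : q.L + q.U + q.M + q.V = X.filter (· ≤ q.v) := by
  have := h.le
  rw [h.L_add_U, h.M, h.V]
  ext a; simp only [Multiset.count_add, Multiset.count_filter]; grind

theorem V_eq (h : IsPartition X q) (huv : q.u < q.v) : q.V = X.filter (· = q.v) := by
  rw [h.V]; simp only [huv, and_true]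

theorem card_eq (h : IsPartition X q) :
    q.L.card + q.U.card + q.M.card + q.V.card + q.R.card = X.card := by
  rw [← Multiset.card_add, ← Multiset.card_add, ← Multiset.card_add, ← Multiset.card_add,
    h.L_add_U_add_M_add_V, h.R, filter_le_add_filter_gt]

end IsPartition

/-- The reduction is correct, provided that `sel` is correct in the call that is made. -/
theorem isSelection_finish {sel : Multiset T → ℕ → PMF (Selection T × ℕ∞)} {X : Multiset T} {k : ℕ}
    {q : Partition T} (hq : IsPartition X q) (hk : 1 ≤ k)
    (hL : k ≤ q.L.card → ∀ r ∈ (sel q.L k).support, IsSelection q.L k r.1)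
    (hR : X.card - q.R.card < k → ∀ r ∈ (sel q.R (k + q.R.card - X.card)).support,
      IsSelection q.R (k + q.R.card - X.card) r.1)
    (hM : (q.L + q.U).card < k → k - (q.L + q.U).card ≤ q.M.card →
      ∀ r ∈ (sel q.M (k - (q.L + q.U).card)).support,
        IsSelection q.M (k - (q.L + q.U).card) r.1) :
    ∀ r ∈ (finish sel X.card k q).support, IsSelection X k r.1 := by
  have hc := hq.card_eq
  have huv := hq.le
  intro r hr
  unfold finish at hr
  simp only [Multiset.card_add] at hr hM
  split_ifs at hr with h1 h2 h3 h4
  · rw [PMF.mem_support_pure_iff] at hr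
    subst hr
    exact ⟨hq.L, hq.U, hq.M_add_V_add_R, h1.1, h1.2⟩
  · rw [PMF.mem_support_pure_iff] at hr
    subst hr
    -- with `u = v` the second test would be `|L ∪ U| < k ≤ n - |R| = |L ∪ U|`
    have huv' : q.u < q.v := by
      refine huv.lt_of_ne fun heq => ?_
      have hM0 : q.M = 0 := by
        rw [hq.M, Multiset.filter_eq_nil]; intro x _ hx
        exact lt_irrefl _ (hx.1.trans (heq ▸ hx.2))
      have hV0 : q.V = 0 := by
        rw [hq.V, Multiset.filter_eq_nil]; intro x _ hx
        exact hx.2.ne heq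
      rw [hM0, hV0] at hc
      rw [hM0] at h2
      simp only [Multiset.card_zero] at hc h2
      omega
    refine ⟨hq.L_add_U_add_M huv', hq.V_eq huv', hq.R, ?_, ?_⟩
    · simpa only [Multiset.card_add] using h2.1
    · simp only [Multiset.card_add]; omega
  · rw [PMF.mem_support_map_iff] at hr
    obtain ⟨r', hr', rfl⟩ := hr
    have hs := hL h3 r' hr'
    have hp : r'.1.pivot < q.u := by
      have := hs.pivot_mem; rw [hq.L, Multiset.mem_filter] at this; exact this.2
    refine ⟨?_, ?_, ?_, hs.card_lt, hs.le_card⟩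
    · change r'.1.lt = X.filter (· < r'.1.pivot)
      rw [hs.lt, hq.L, Multiset.filter_filter]
      exact Multiset.filter_congr fun x _ => ⟨fun h => h.1, fun h => ⟨h, h.trans hp⟩⟩
    · change r'.1.eq = X.filter (· = r'.1.pivot)
      rw [hs.eq, hq.L, Multiset.filter_filter]
      exact Multiset.filter_congr fun x _ => ⟨fun h => h.1, fun h => ⟨h, h ▸ hp⟩⟩
    · change r'.1.gt + q.U + q.M + q.V + q.R = X.filter (r'.1.pivot < ·)
      rw [hs.gt, add_assoc, add_assoc, add_assoc, ← add_assoc q.M, hq.M_add_V_add_R, hq.U, hq.L]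
      ext a; simp only [Multiset.count_add, Multiset.count_filter]; grind
  · rw [PMF.mem_support_map_iff] at hr
    obtain ⟨r', hr', rfl⟩ := hr
    have hs := hR h4 r' hr'
    have hp : q.v < r'.1.pivot := by
      have := hs.pivot_mem; rw [hq.R, Multiset.mem_filter] at this; exact this.2
    have c1 := hs.card_lt
    have c2 := hs.le_card
    refine ⟨?_, ?_, ?_, ?_, ?_⟩
    · change q.L + q.U + q.M + q.V + r'.1.lt = X.filter (· < r'.1.pivot)
      rw [hs.lt, hq.L_add_U_add_M_add_V, hq.R]
      ext a; simp only [Multiset.count_add, Multiset.count_filter]; grind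
    · change r'.1.eq = X.filter (· = r'.1.pivot)
      rw [hs.eq, hq.R, Multiset.filter_filter]
      exact Multiset.filter_congr fun x _ => ⟨fun h => h.1, fun h => ⟨h, h ▸ hp⟩⟩
    · change r'.1.gt = X.filter (r'.1.pivot < ·)
      rw [hs.gt, hq.R, Multiset.filter_filter]
      exact Multiset.filter_congr fun x _ => ⟨fun h => h.1, fun h => ⟨h, hp.trans h⟩⟩
    · simp only [Multiset.card_add]; omega
    · simp only [Multiset.card_add]; omega
  · rw [PMF.mem_support_map_iff] at hr
    obtain ⟨r', hr', rfl⟩ := hr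
    have hs := hM (by omega) (by omega) r' hr'
    have hp : q.u < r'.1.pivot ∧ r'.1.pivot < q.v := by
      have := hs.pivot_mem; rw [hq.M, Multiset.mem_filter] at this; exact this.2
    have c1 := hs.card_lt
    have c2 := hs.le_card
    refine ⟨?_, ?_, ?_, ?_, ?_⟩
    · change q.L + q.U + r'.1.lt = X.filter (· < r'.1.pivot)
      rw [hs.lt, hq.L_add_U, hq.M]
      ext a; simp only [Multiset.count_add, Multiset.count_filter]; grind
    · change r'.1.eq = X.filter (· = r'.1.pivot)
      rw [hs.eq, hq.M, Multiset.filter_filter]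
      exact Multiset.filter_congr fun x _ => ⟨fun h => h.1, fun h => ⟨h, h ▸ hp⟩⟩
    · change r'.1.gt + q.V + q.R = X.filter (r'.1.pivot < ·)
      rw [hs.gt, hq.M, hq.V, hq.R]
      ext a; simp only [Multiset.count_add, Multiset.count_filter]; grind
    · simp only [Multiset.card_add]; omega
    · simp only [Multiset.card_add]; omega

end Correctness

/-! ### Positions of the pivots and balanced samples -/

section Ranks

/-- The `j` smallest positions. -/
def lowest (n j : ℕ) : Finset (Fin n) := Finset.univ.filter fun i => (i : ℕ) < j

/-- The `j` largest positions. -/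
def highest (n j : ℕ) : Finset (Fin n) := Finset.univ.filter fun i => n - j ≤ (i : ℕ)

theorem card_lowest {n j : ℕ} (h : j ≤ n) : (lowest n j).card = j := by
  have h1 : lowest n j = Finset.univ.map (Fin.castLEEmb h) := by
    ext i
    simp only [lowest, Finset.mem_filter, Finset.mem_univ, true_and, Finset.mem_map]
    exact ⟨fun hi => ⟨⟨i, hi⟩, rfl⟩, fun ⟨a, ha⟩ => ha ▸ a.2⟩
  rw [h1, Finset.card_map, Finset.card_univ, Fintype.card_fin]

theorem card_highest {n j : ℕ} (h : j ≤ n) : (highest n j).card = j := by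
  have h1 : highest n j = (lowest n (n - j))ᶜ := by
    ext i; simp [lowest, highest]
  rw [h1, Finset.card_compl, card_lowest (Nat.sub_le n j), Fintype.card_fin]
  omega

theorem card_filter_map {T : Type u} {n : ℕ} (x : Fin n → T) (t : Finset (Fin n)) (p : T → Prop)
    [DecidablePred p] : ((t.val.map x).filter p).card = (t.filter fun i => p (x i)).card := by
  rw [Multiset.filter_map, Multiset.card_map]; rfl

variable {T : Type u} [LinearOrder T] {n : ℕ} {x : Fin n → T}

/-- If at least `j` elements are below `w`, then so are those at the `j` lowest positions. -/
theorem lt_of_mem_lowest (hx : Monotone x) {j : ℕ} {w : T}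
    (hj : j ≤ ((Finset.univ.val.map x).filter (· < w)).card) {i : Fin n} (hi : i ∈ lowest n j) :
    x i < w := by
  by_contra! hw
  rw [card_filter_map] at hj
  have h1 : (Finset.univ.filter fun i => x i < w) ⊆ lowest n i := by
    intro i' hi'
    simp only [lowest, Finset.mem_filter, Finset.mem_univ, true_and] at hi' ⊢
    by_contra! hle
    exact (hi'.trans_le hw).not_ge (hx hle)
  have h2 := (hj.trans (Finset.card_le_card h1)).trans_eq (card_lowest i.2.le)
  simp only [lowest, Finset.mem_filter, Finset.mem_univ, true_and] at hi
  omega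

/-- If at least `j` elements are above `w`, then so are those at the `j` highest positions. -/
theorem lt_of_mem_highest (hx : Monotone x) {j : ℕ} {w : T}
    (hj : j ≤ ((Finset.univ.val.map x).filter (w < ·)).card) {i : Fin n} (hi : i ∈ highest n j) :
    w < x i := by
  by_contra! hw
  rw [card_filter_map] at hj
  have h1 : (Finset.univ.filter fun i => w < x i) ⊆ highest n (n - (i + 1)) := by
    intro i' hi'
    simp only [highest, Finset.mem_filter, Finset.mem_univ, true_and] at hi' ⊢
    have hlt : (i : ℕ) < i' := by
      by_contra! hle
      exact (hw.trans_lt hi').not_ge (hx hle)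
    omega
  have h2 := (hj.trans (Finset.card_le_card h1)).trans_eq (card_highest (Nat.sub_le _ _))
  simp only [highest, Finset.mem_filter, Finset.mem_univ, true_and] at hi
  have := i.2
  omega

theorem card_inter_lowest_le (hx : Monotone x) {j : ℕ} {w : T}
    (hj : j ≤ ((Finset.univ.val.map x).filter (· < w)).card) (t : Finset (Fin n)) :
    (t ∩ lowest n j).card ≤ ((t.val.map x).filter (· < w)).card := by
  rw [card_filter_map]
  refine Finset.card_le_card fun i hi => ?_
  rw [Finset.mem_inter] at hi
  exact Finset.mem_filter.2 ⟨hi.1, lt_of_mem_lowest hx hj hi.2⟩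

theorem card_inter_highest_le (hx : Monotone x) {j : ℕ} {w : T}
    (hj : j ≤ ((Finset.univ.val.map x).filter (w < ·)).card) (t : Finset (Fin n)) :
    (t ∩ highest n j).card ≤ ((t.val.map x).filter (w < ·)).card := by
  rw [card_filter_map]
  refine Finset.card_le_card fun i hi => ?_
  rw [Finset.mem_inter] at hi
  exact Finset.mem_filter.2 ⟨hi.1, lt_of_mem_highest hx hj hi.2⟩

theorem card_filter_lt_le {n : ℕ} (x : Fin n → T) (w : T) :
    ((Finset.univ.val.map x).filter (· < w)).card ≤ n := by
  refine (Multiset.card_le_card (Multiset.filter_le _ _)).trans ?_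
  simp

theorem card_filter_gt_le {n : ℕ} (x : Fin n → T) (w : T) :
    ((Finset.univ.val.map x).filter (w < ·)).card ≤ n := by
  refine (Multiset.card_le_card (Multiset.filter_le _ _)).trans ?_
  simp

/-- The sample `t` of `s` positions contains fewer elements of `A` than expected, by `g` or more. -/
def Deficient {n : ℕ} (s : ℕ) (g : ℝ) (A t : Finset (Fin n)) : Prop :=
  ((t ∩ A).card : ℝ) ≤ A.card * s / n - g

/-- The sample is deficient in one of four extreme sets of positions. In turn, these failures would
allow too many elements below `u`, above `v`, above `u` and below `v`, if the `k`th smallest element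
is sought and `D` positions are tolerated. -/
def Unbalanced (n s k D : ℕ) (g : ℝ) (t : Finset (Fin n)) : Prop :=
  Deficient s g (lowest n (max k D)) t ∨ Deficient s g (highest n (max (n - k + 1) D)) t ∨
    Deficient s g (highest n (n - k + D)) t ∨ Deficient s g (lowest n (k + D)) t

/-- The pivot ranks `iu ≤ iv` enclose the expected rank `k s / n`, at distance `g` up to
truncation. -/
structure RankBounds (n s k iu iv : ℕ) (g : ℝ) : Prop where
  nonneg : 0 ≤ g
  pos : 1 ≤ iu
  le : iu ≤ iv
  le_s : iv ≤ s
  lo_u : (k : ℝ) * s / n - g ≤ iu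
  hi_u : (iu : ℝ) - 1 ≤ max ((k : ℝ) * s / n - g) 0
  lo_v : min ((k : ℝ) * s / n + g) s ≤ iv
  hi_v : (iv : ℝ) - 1 ≤ (k : ℝ) * s / n + g

variable {s k iu iv D : ℕ} {g : ℝ}

section Balanced

variable (hx : Monotone x) (hk : k ≤ n) (hb : RankBounds n s k iu iv g)
  (hD : 2 * g ≤ (D : ℝ) * s / n) {t : Finset (Fin n)} (ht : t.card = s)
  (hbal : ¬ Unbalanced n s k D g t) {u v : T}
  (hu : IsRank (t.val.map x) iu u) (hv : IsRank (t.val.map x) iv v)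

include ht in
theorem card_filter_gt_add_le {i : ℕ} {w : T} (hw : IsRank (t.val.map x) i w) :
    ((t.val.map x).filter (w < ·)).card + i ≤ s := by
  have h1 := congrArg Multiset.card (filter_le_add_filter_gt (t.val.map x) w)
  rw [Multiset.card_add, Multiset.card_map, Finset.card_val, ht] at h1
  have := hw.2
  omega

include hx hb hD hbal hu in
/-- If the final call is on the elements below `u`, then they are few. -/
theorem card_below_u_lt (hL : k ≤ ((Finset.univ.val.map x).filter (· < u)).card) :
    ((Finset.univ.val.map x).filter (· < u)).card < D := by
  by_contra! hDL
  refine hbal (Or.inl ?_)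
  have hj := max_le hL hDL
  have h1 := card_inter_lowest_le hx hj t
  have h2 : (((t ∩ lowest n (max k D)).card + 1 : ℕ) : ℝ) ≤ iu :=
    Nat.cast_le.2 (Nat.succ_le_of_lt (h1.trans_lt hu.1))
  rw [Deficient, card_lowest (hj.trans (card_filter_lt_le x u))]
  have h0 := hb.nonneg
  have h3 := hb.hi_u
  have h4 : (k : ℝ) * s / n ≤ (max k D : ℕ) * s / n := by gcongr; exact le_max_left _ _
  have h5 : (D : ℝ) * s / n ≤ (max k D : ℕ) * s / n := by gcongr; exact le_max_right _ _
  push_cast at h2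
  rcases max_cases ((k : ℝ) * s / n - g) 0 with h6 | h6 <;> linarith

include hx hb hD ht hbal hv hk in
/-- If the final call is on the elements above `v`, then they are few. -/
theorem card_above_v_lt (hn : 0 < n)
    (hR : n - k + 1 ≤ ((Finset.univ.val.map x).filter (v < ·)).card) :
    ((Finset.univ.val.map x).filter (v < ·)).card < D := by
  by_contra! hDR
  refine hbal (Or.inr (Or.inl ?_))
  have hj := max_le hR hDR
  have h1 := card_inter_highest_le hx hj t
  have h2 : (((t ∩ highest n (max (n - k + 1) D)).card + iv : ℕ) : ℝ) ≤ s :=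
    Nat.cast_le.2 ((Nat.add_le_add_right h1 _).trans (card_filter_gt_add_le ht hv))
  rw [Deficient, card_highest (hj.trans (card_filter_gt_le x v))]
  have h0 := hb.nonneg
  have h3 := hb.lo_v
  have hn0 : (n : ℝ) ≠ 0 := by positivity
  have h4 : s - (k : ℝ) * s / n ≤ (max (n - k + 1) D : ℕ) * s / n := by
    have : s - (k : ℝ) * s / n = ((n - k : ℕ) : ℝ) * s / n := by
      rw [Nat.cast_sub hk]; field_simp
    rw [this]
    gcongr
    exact (Nat.le_succ _).trans (le_max_left _ _)
  have h5 : (D : ℝ) * s / n ≤ (max (n - k + 1) D : ℕ) * s / n := by gcongr; exact le_max_right _ _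
  push_cast at h2
  rcases min_cases ((k : ℝ) * s / n + g) s with h6 | h6 <;> linarith

include hx hb hD ht hbal hu hk in
theorem card_above_u_lt (hn : 0 < n) :
    ((Finset.univ.val.map x).filter (u < ·)).card < n - k + D := by
  by_contra! hj
  refine hbal (Or.inr (Or.inr (Or.inl ?_)))
  have h1 := card_inter_highest_le hx hj t
  have h2 : (((t ∩ highest n (n - k + D)).card + iu : ℕ) : ℝ) ≤ s :=
    Nat.cast_le.2 ((Nat.add_le_add_right h1 _).trans (card_filter_gt_add_le ht hu))
  rw [Deficient, card_highest (hj.trans (card_filter_gt_le x u))]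
  have h3 := hb.lo_u
  have hn0 : (n : ℝ) ≠ 0 := by positivity
  have h4 : ((n - k + D : ℕ) : ℝ) * s / n = s - (k : ℝ) * s / n + D * s / n := by
    rw [Nat.cast_add, Nat.cast_sub hk]; field_simp
  push_cast at h2
  linarith

include hx hb hD hbal hv in
theorem card_below_v_lt :
    ((Finset.univ.val.map x).filter (· < v)).card < k + D := by
  by_contra! hj
  refine hbal (Or.inr (Or.inr (Or.inr ?_)))
  have h1 := card_inter_lowest_le hx hj t
  have h2 : (((t ∩ lowest n (k + D)).card + 1 : ℕ) : ℝ) ≤ iv :=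
    Nat.cast_le.2 (Nat.succ_le_of_lt (h1.trans_lt hv.1))
  rw [Deficient, card_lowest (hj.trans (card_filter_lt_le x v))]
  have h3 := hb.hi_v
  have h4 : ((k + D : ℕ) : ℝ) * s / n = (k : ℝ) * s / n + D * s / n := by
    rw [Nat.cast_add]; ring
  push_cast at h2
  linarith

include hx hb hD ht hbal hu hv hk in
/-- The elements strictly between the pivots are counted twice among those below `v` and those
above `u`, and all others at least once. -/
theorem card_between_le (hn : 0 < n) :
    ((Finset.univ.val.map x).filter fun y => u < y ∧ y < v).card ≤ 2 * D := by
  rcases lt_or_ge u v with huv | huv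
  · have h1 := card_below_v_lt hx hb hD hbal hv
    have h2 := card_above_u_lt hx hk hb hD ht hbal hu hn
    have h3 : (Finset.univ.val.map x).filter (u < ·) + (Finset.univ.val.map x).filter (· < v) =
        Finset.univ.val.map x + (Finset.univ.val.map x).filter fun y => u < y ∧ y < v := by
      ext a; simp only [Multiset.count_add, Multiset.count_filter]; grind
    have h4 := congrArg Multiset.card h3
    rw [Multiset.card_add, Multiset.card_add, Multiset.card_map, Finset.card_val, Finset.card_univ,
      Fintype.card_fin] at h4
    omega
  · rw [Multiset.filter_eq_nil.2 fun y _ hy => ((hy.1.trans hy.2).not_ge huv)]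
    simp

end Balanced

open Classical in
/-- The number of unbalanced samples, by the union bound. -/
theorem card_unbalanced_le (hs : s ≤ n) (hs0 : 0 < s) (hg : 0 ≤ g) :
    ((((Finset.univ : Finset (Fin n)).powersetCard s).filter (Unbalanced n s k D g)).card : ℝ) ≤
      n.choose s * (4 * Real.exp (-2 * g ^ 2 / s)) := by
  have h1 (A : Finset (Fin n)) :
      ((((Finset.univ : Finset (Fin n)).powersetCard s).filter (Deficient s g A)).card : ℝ) ≤
        n.choose s * Real.exp (-2 * g ^ 2 / s) := by
    have := card_filter_card_inter_le (s := s) (by simpa using hs) hs0 A hg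
    rw [Fintype.card_fin] at this
    convert this using 3
    exact Finset.filter_congr fun t _ => Iff.rfl
  set P := (Finset.univ : Finset (Fin n)).powersetCard s
  have h2 : P.filter (Unbalanced n s k D g) ⊆
      P.filter (Deficient s g (lowest n (max k D))) ∪
      (P.filter (Deficient s g (highest n (max (n - k + 1) D))) ∪
      (P.filter (Deficient s g (highest n (n - k + D))) ∪
      P.filter (Deficient s g (lowest n (k + D))))) := by
    rw [← Finset.filter_or, ← Finset.filter_or, ← Finset.filter_or]
    exact Finset.monotone_filter_right _ fun t _ ht => ht
  have h3 := (Finset.card_le_card h2).trans ((Finset.card_union_le _ _).trans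
    (Nat.add_le_add_left ((Finset.card_union_le _ _).trans
    (Nat.add_le_add_left (Finset.card_union_le _ _) _)) _))
  have h4 : ((P.filter (Unbalanced n s k D g)).card : ℝ) ≤ _ := Nat.cast_le.2 h3
  push_cast at h4
  linarith [h1 (lowest n (max k D)), h1 (highest n (max (n - k + 1) D)),
    h1 (highest n (n - k + D)), h1 (lowest n (k + D))]

/-- The pivot ranks of the algorithm satisfy `RankBounds`. -/
theorem rankBounds (a b : ℝ) {n k : ℕ} (hn : 0 < n) (hs : 0 < sampleSize a n) (hk1 : 1 ≤ k)
    (hk : k ≤ n) :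
    RankBounds n (sampleSize a n) k (lowRank a b n k) (highRank a b n k) (gap a b n) := by
  set s := sampleSize a n
  have hg : 0 ≤ gap a b n := Real.sqrt_nonneg _
  set g := gap a b n
  have hs1 : (0 : ℝ) < s := by exact_mod_cast hs
  have hks0 : 0 < (k : ℝ) * s / n := by positivity
  have hks : (k : ℝ) * s / n ≤ s := by
    rw [div_le_iff₀ (by positivity), mul_comm]
    gcongr
  have hlo : lowRank a b n k = max ⌈(k : ℝ) * s / n - g⌉₊ 1 := rfl
  have hhi : highRank a b n k = min ⌈(k : ℝ) * s / n + g⌉₊ s := rfl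
  have hceil : (⌈(k : ℝ) * s / n + g⌉₊ : ℝ) < (k : ℝ) * s / n + g + 1 :=
    Nat.ceil_lt_add_one (by positivity)
  rw [hlo, hhi]
  refine ⟨hg, le_max_right _ _, ?_, min_le_right _ _, ?_, ?_, ?_, ?_⟩
  · refine max_le (le_min (Nat.ceil_mono (by linarith)) ?_) (le_min (Nat.ceil_pos.2 ?_) hs)
    · exact Nat.ceil_le.2 (by linarith)
    · positivity
  · exact (Nat.le_ceil _).trans (Nat.cast_le.2 (le_max_left _ _))
  · rw [Nat.cast_max, Nat.cast_one, sub_le_iff_le_add, max_add, zero_add]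
    rcases le_total 0 ((k : ℝ) * s / n - g) with h0 | h0
    · exact max_le_max (Nat.ceil_lt_add_one h0).le le_rfl
    · rw [Nat.ceil_eq_zero.2 h0]
      exact max_le (by simp) (le_max_right _ _)
  · rw [Nat.cast_min]
    exact min_le_min_right _ (Nat.le_ceil _)
  · have : ((min ⌈(k : ℝ) * s / n + g⌉₊ s : ℕ) : ℝ) ≤ ⌈(k : ℝ) * s / n + g⌉₊ :=
      Nat.cast_le.2 (min_le_left _ _)
    linarith

end Ranks

/-! ### Expected cost for a fixed sample -/

section Cost

variable {T : Type u}

/-- The expected number of comparisons of a randomized routine. -/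
noncomputable def expectedCost {α : Type*} (p : PMF (α × ℕ∞)) : ℝ≥0∞ :=
  expect p fun r => (r.2 : ℝ≥0∞)

/-- The routine `sel` selects correctly from fewer than `n` elements, with at most `H m` expected
comparisons for `m` elements. -/
def Solves [LinearOrder T] (sel : Multiset T → ℕ → PMF (Selection T × ℕ∞)) (H : ℕ → ℝ≥0∞) (n : ℕ) :
    Prop :=
  ∀ (Y : Multiset T) (j : ℕ), 1 ≤ j → j ≤ Y.card → Y.card < n →
    (∀ r ∈ (sel Y j).support, IsSelection Y j r.1) ∧ expectedCost (sel Y j) ≤ H Y.card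

theorem expectedCost_finish_le {sel : Multiset T → ℕ → PMF (Selection T × ℕ∞)} {n k : ℕ}
    {q : Partition T} {c : ℝ≥0∞} (hL : k ≤ q.L.card → expectedCost (sel q.L k) ≤ c)
    (hR : n - q.R.card < k → expectedCost (sel q.R (k + q.R.card - n)) ≤ c)
    (hM : (q.L + q.U).card < k → k ≤ n - q.R.card → ¬ (q.L + q.U + q.M).card < k →
      expectedCost (sel q.M (k - (q.L + q.U).card)) ≤ c) :
    expectedCost (finish sel n k q) ≤ c := by
  unfold finish
  split_ifs with h1 h2 h3 h4
  · rw [expectedCost, expect_pure]; simp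
  · rw [expectedCost, expect_pure]; simp
  · rw [expectedCost, expect_map]; exact hL h3
  · rw [expectedCost, expect_map]; exact hR h4
  · rw [expectedCost, expect_map]
    simp only [Multiset.card_add] at *
    exact hM (by omega) (by omega) (by omega)

theorem card_filter_lt_card {X : Multiset T} {w : T} (hw : w ∈ X) (p : T → Prop) [DecidablePred p]
    (hp : ¬ p w) : (X.filter p).card < X.card := by
  refine Multiset.card_lt_card (lt_of_le_of_ne (Multiset.filter_le _ _) fun h => ?_)
  exact hp (Multiset.filter_eq_self.1 h w hw)

variable [LinearOrder T]

/-- Each element is compared with one pivot, and a second time only if it lies below `v`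
(for `k < n / 2`) or above `u` (for `k ≥ n / 2`). -/
theorem partitionCost_le (n k : ℕ) (u v : T) (Y : Multiset T) :
    partitionCost n k u v Y ≤ Y.card +
      (if 2 * k < n then (Y.filter (· < v)).card else (Y.filter (u < ·)).card) := by
  unfold partitionCost comparisonsFor
  induction Y using Multiset.induction_on with
  | empty => simp
  | cons x Y ih =>
    rw [Multiset.map_cons, Multiset.sum_cons, Multiset.card_cons, Multiset.filter_cons,
      Multiset.filter_cons, Multiset.card_add, Multiset.card_add]
    by_cases h1 : 2 * k < n
    · simp only [h1, if_true] at ih ⊢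
      by_cases h2 : x < v
      · have : (if x < v ∧ u < v then 1 else 0) ≤ 1 := by split_ifs <;> simp
        simp only [h2, if_true, Multiset.card_singleton, true_and] at this ⊢
        omega
      · simp only [h2, if_false, Multiset.card_zero, false_and]
        omega
    · simp only [h1, if_false] at ih ⊢
      by_cases h2 : u < x
      · have : (if u < x ∧ u < v then 1 else 0) ≤ 1 := by split_ifs <;> simp
        simp only [h2, if_true, Multiset.card_singleton, true_and] at this ⊢
        omega
      · simp only [h2, if_false, Multiset.card_zero, false_and]
        omega

theorem IsRank.mem {X : Multiset T} {k : ℕ} {w : T} (h : IsRank X k w) : w ∈ X := by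
  have h1 := congrArg Multiset.card (filter_lt_add_filter_eq X w)
  rw [Multiset.card_add] at h1
  have h2 : 0 < (X.filter (· = w)).card := by have := h.1; have := h.2; omega
  obtain ⟨y, hy⟩ := Multiset.card_pos_iff_exists_mem.1 h2
  rw [Multiset.mem_filter] at hy
  exact hy.2 ▸ hy.1

variable {sel : Multiset T → ℕ → PMF (Selection T × ℕ∞)} {H : ℕ → ℝ≥0∞} {n : ℕ}

theorem mem_support_selectPivots {S : Multiset T} {iu iv : ℕ} (hsel : Solves sel H n)
    (hS : S.card < n) (h1 : 1 ≤ iu) (h2 : iu ≤ iv) (h3 : iv ≤ S.card) {p : Partition T × ℕ∞}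
    (hp : p ∈ (selectPivots sel S iu iv).support) :
    IsPartition S p.1 ∧ IsRank S iu p.1.u ∧ IsRank S iv p.1.v := by
  rw [selectPivots, PMF.mem_support_bind_iff] at hp
  obtain ⟨ru, hru, hp⟩ := hp
  have hu := (hsel S iu h1 (h2.trans h3) hS).1 ru hru
  split_ifs at hp with h
  · rw [PMF.mem_support_bind_iff] at hp
    obtain ⟨rv, hrv, hp⟩ := hp
    rw [PMF.mem_support_pure_iff] at hp
    subst hp
    have hc := hu.card_dropSmallest
    have hv := (hsel (dropSmallest ru.1 iu) (iv - iu) (by omega) (by omega) (by omega)).1 rv hrv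
    obtain ⟨hle, hr⟩ := pivot_le_and_isRank h hu hv
    refine ⟨isPartition_twoPivots hu hv, ?_⟩
    change IsRank S iu (twoPivots ru.1 rv.1 iu).u ∧ IsRank S iv (twoPivots ru.1 rv.1 iu).v
    unfold twoPivots
    split_ifs with huv
    · exact ⟨hu.isRank, hr⟩
    · have heq : ru.1.pivot = rv.1.pivot := le_antisymm hle (not_lt.1 huv)
      refine ⟨hu.isRank, ?_⟩
      change IsRank S iv ru.1.pivot
      rwa [heq]
  · rw [PMF.mem_support_pure_iff] at hp
    subst hp
    obtain rfl : iu = iv := by omega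
    exact ⟨isPartition_singlePivot hu, hu.isRank, hu.isRank⟩

theorem expectedCost_selectPivots_le {S : Multiset T} {iu iv : ℕ} (hH : Monotone H)
    (hsel : Solves sel H n) (hS : S.card < n) (h1 : 1 ≤ iu) (h2 : iu ≤ iv) (h3 : iv ≤ S.card) :
    expectedCost (selectPivots sel S iu iv) ≤ H S.card + H S.card := by
  rw [expectedCost, selectPivots, expect_bind]
  calc _ ≤ expect (sel S iu) fun ru => (ru.2 : ℝ≥0∞) + H S.card := by
        refine expect_mono fun ru hru => ?_
        have hu := (hsel S iu h1 (h2.trans h3) hS).1 ru hru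
        split_ifs with h
        · have hc := hu.card_dropSmallest
          have hv := (hsel (dropSmallest ru.1 iu) (iv - iu) (by omega) (by omega) (by omega)).2
          rw [expect_bind]
          simp only [expect_pure, ENat.toENNReal_add]
          rw [expect_add, expect_const]
          gcongr
          exact hv.trans (hH (by omega))
        · rw [expect_pure]
          exact le_self_add
    _ = expectedCost (sel S iu) + H S.card := by rw [expect_add, expect_const, expectedCost]
    _ ≤ _ := by
        gcongr
        exact (hsel S iu h1 (h2.trans h3) hS).2

/-- The part of `selectStep` that follows the choice of the sample `S`. -/
noncomputable def selectWithSample (sel : Multiset T → ℕ → PMF (Selection T × ℕ∞))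
    (X S : Multiset T) (k iu iv : ℕ) : PMF (Selection T × ℕ∞) :=
  (selectPivots sel S iu iv).bind fun p =>
    (finish sel X.card k (extendPartition p.1 (X - S))).map fun r =>
      (r.1, p.2 + (partitionCost X.card k p.1.u p.1.v (X - S) : ℕ) + r.2)

theorem selectStep_eq (a b : ℝ) (sel : Multiset T → ℕ → PMF (Selection T × ℕ∞)) {X : Multiset T}
    (hX : X.card ≠ 1) (k : ℕ) :
    selectStep a b sel X k =
      (uniformSample X (sampleSize a X.card) (sampleSize_le a X.card)).bind fun S =>
        selectWithSample sel X S k (lowRank a b X.card k) (highRank a b X.card k) := by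
  rw [selectStep, dif_neg hX]; rfl

section WithSample

variable {X S : Multiset T} {k iu iv : ℕ} (hsel : Solves sel H X.card) (hSX : S ≤ X)
  (hS : S.card < X.card) (h1 : 1 ≤ iu) (h2 : iu ≤ iv) (h3 : iv ≤ S.card) (hk1 : 1 ≤ k)
  (hk : k ≤ X.card)

include hSX in
/-- The sets on which the final call may be made miss a pivot, hence are smaller than `X`. -/
theorem card_parts_lt {p : Partition T} (hq : IsPartition X (extendPartition p (X - S)))
    (hu : IsRank S iu p.u) (hv : IsRank S iv p.v) :
    (extendPartition p (X - S)).L.card < X.card ∧ (extendPartition p (X - S)).R.card < X.card ∧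
      (extendPartition p (X - S)).M.card < X.card := by
  have huX := Multiset.mem_of_le hSX hu.mem
  have hvX := Multiset.mem_of_le hSX hv.mem
  refine ⟨?_, ?_, ?_⟩
  · rw [hq.L]; exact card_filter_lt_card huX _ (lt_irrefl _)
  · rw [hq.R]; exact card_filter_lt_card hvX _ (lt_irrefl _)
  · rw [hq.M]; exact card_filter_lt_card huX _ fun h => lt_irrefl _ h.1

include hsel hSX hS h1 h2 h3 hk1 hk in
theorem isSelection_selectWithSample :
    ∀ r ∈ (selectWithSample sel X S k iu iv).support, IsSelection X k r.1 := by
  intro r hr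
  rw [selectWithSample, PMF.mem_support_bind_iff] at hr
  obtain ⟨p, hp, hr⟩ := hr
  obtain ⟨hpS, hu, hv⟩ := mem_support_selectPivots hsel hS h1 h2 h3 hp
  have hq := isPartition_extendPartition hSX hpS
  obtain ⟨cL, cR, cM⟩ := card_parts_lt hSX hq hu hv
  rw [PMF.mem_support_map_iff] at hr
  obtain ⟨r', hr', rfl⟩ := hr
  refine isSelection_finish hq hk1 ?_ ?_ ?_ r' hr'
  · exact fun h => (hsel _ k hk1 h cL).1
  · exact fun h => (hsel _ _ (by omega) (by omega) cR).1
  · exact fun h h' => (hsel _ _ (by omega) h' cM).1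

include hsel hSX hS h1 h2 h3 hk1 hk in
/-- The expected cost for a fixed sample: `N` bounds the number of elements that are compared with
both pivots, and `m` the size of the final call. -/
theorem expectedCost_selectWithSample_le (hH : Monotone H) {N m : ℕ}
    (hN : ∀ u v, IsRank S iu u → IsRank S iv v →
      (if 2 * k < X.card then (X.filter (· < v)).card else (X.filter (u < ·)).card) ≤ N)
    (hL : ∀ u, IsRank S iu u → k ≤ (X.filter (· < u)).card → (X.filter (· < u)).card ≤ m)
    (hR : ∀ v, IsRank S iv v → X.card < k + (X.filter (v < ·)).card →
      (X.filter (v < ·)).card ≤ m)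
    (hM : ∀ u v, IsRank S iu u → IsRank S iv v → (X.filter fun x => u < x ∧ x < v).card ≤ m) :
    expectedCost (selectWithSample sel X S k iu iv) ≤
      H S.card + H S.card + (X.card + N : ℕ) + H m := by
  rw [expectedCost, selectWithSample, expect_bind]
  calc _ ≤ expect (selectPivots sel S iu iv) fun p =>
        (p.2 : ℝ≥0∞) + ((X.card + N : ℕ) + H m) := by
        refine expect_mono fun p hp => ?_
        obtain ⟨hpS, hu, hv⟩ := mem_support_selectPivots hsel hS h1 h2 h3 hp
        have hq := isPartition_extendPartition hSX hpS
        obtain ⟨cL, cR, cM⟩ := card_parts_lt hSX hq hu hv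
        have hc := hq.card_eq
        have hY : X - S ≤ X := tsub_le_self
        have hcost : partitionCost X.card k p.1.u p.1.v (X - S) ≤ X.card + N := by
          refine (partitionCost_le _ _ _ _ _).trans (Nat.add_le_add (Multiset.card_le_card hY) ?_)
          refine le_trans ?_ (hN _ _ hu hv)
          split_ifs
          · exact Multiset.card_le_card (Multiset.filter_le_filter _ hY)
          · exact Multiset.card_le_card (Multiset.filter_le_filter _ hY)
        have hfin : expectedCost (finish sel X.card k (extendPartition p.1 (X - S))) ≤ H m := by
          refine expectedCost_finish_le (fun h => ?_) (fun h => ?_) (fun h h' h'' => ?_)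
          · refine (hsel _ k hk1 h cL).2.trans (hH ?_)
            rw [hq.L] at h ⊢
            exact hL _ hu h
          · refine (hsel _ _ (by omega) (by omega) cR).2.trans (hH ?_)
            rw [hq.R] at h ⊢
            exact hR _ hv (by omega)
          · simp only [Multiset.card_add] at h h' h'' ⊢
            refine (hsel _ _ (by omega) (by omega) cM).2.trans (hH ?_)
            rw [hq.M]
            exact hM _ _ hu hv
        rw [expect_map]
        simp only [ENat.toENNReal_add, add_assoc]
        rw [expect_add, expect_const, expect_add, expect_const]
        gcongr
        · rw [ENat.toENNReal_coe]
          exact_mod_cast hcost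
        · exact hfin
    _ = expectedCost (selectPivots sel S iu iv) + ((X.card + N : ℕ) + H m) := by
        rw [expect_add, expect_const, expectedCost]
    _ ≤ _ := by
        rw [add_assoc (H S.card + H S.card)]
        gcongr
        exact expectedCost_selectPivots_le hH hsel hS h1 h2 h3

end WithSample
end Cost

/-! ### The recurrence for the expected cost -/

section Step

theorem rate_nonneg (n : ℕ) : 0 ≤ rate n :=
  mul_nonneg (Real.rpow_nonneg n.cast_nonneg _) (Real.rpow_nonneg (Real.log_natCast_nonneg n) _)

theorem rate_pos {n : ℕ} (hn : 2 ≤ n) : 0 < rate n := by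
  have h1 : (1 : ℝ) < n := by exact_mod_cast hn
  exact mul_pos (Real.rpow_pos_of_pos (by linarith) _) (Real.rpow_pos_of_pos (Real.log_pos h1) _)

theorem sampleSize_pos {a : ℝ} (ha : 0 < a) {n : ℕ} (hn : 2 ≤ n) : 0 < sampleSize a n :=
  lt_min (Nat.ceil_pos.2 (mul_pos ha (rate_pos hn))) (by omega)

theorem sampleSize_lt (a : ℝ) {n : ℕ} (hn : 2 ≤ n) : sampleSize a n < n :=
  (min_le_right _ _).trans_lt (by omega)

variable {T : Type u} [LinearOrder T] {a : ℝ} (b : ℝ)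
  {sel : Multiset T → ℕ → PMF (Selection T × ℕ∞)} {H : ℕ → ℝ≥0∞} {X : Multiset T} {k : ℕ}
  (ha : 0 < a) (hX : 2 ≤ X.card) (hk1 : 1 ≤ k) (hk : k ≤ X.card) (hsel : Solves sel H X.card)

include ha hX hk1 hk hsel

theorem isSelection_selectStep :
    ∀ r ∈ (selectStep a b sel X k).support, IsSelection X k r.1 := by
  intro r hr
  rw [selectStep_eq a b sel (by omega) k, PMF.mem_support_bind_iff] at hr
  obtain ⟨S, hS, hr⟩ := hr
  obtain ⟨hSX, hSs⟩ := mem_support_uniformSample hS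
  have hb := rankBounds a b (by omega) (sampleSize_pos ha hX) hk1 hk
  exact isSelection_selectWithSample hsel hSX (hSs ▸ sampleSize_lt a hX) hb.pos hb.le
    (hSs ▸ hb.le_s) hk1 hk r hr

/-- A bound for the cost with an arbitrary sample. -/
theorem expectedCost_selectWithSample_le_crude (hH : Monotone H) {S : Multiset T} (hSX : S ≤ X)
    (hSs : S.card = sampleSize a X.card) :
    expectedCost (selectWithSample sel X S k (lowRank a b X.card k) (highRank a b X.card k)) ≤
      H (sampleSize a X.card) + H (sampleSize a X.card) + (X.card + X.card : ℕ) +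
        H (X.card - 1) := by
  have hb := rankBounds a b (by omega) (sampleSize_pos ha hX) hk1 hk
  have h := expectedCost_selectWithSample_le hsel hSX (hSs ▸ sampleSize_lt a hX) hb.pos hb.le
    (hSs ▸ hb.le_s) hk1 hk hH (N := X.card) (m := X.card - 1) ?_ ?_ ?_ ?_
  · rwa [hSs] at h
  · intro u v _ _
    split_ifs
    · exact Multiset.card_le_card (Multiset.filter_le _ _)
    · exact Multiset.card_le_card (Multiset.filter_le _ _)
  · intro u hu _
    exact Nat.le_sub_one_of_lt
      (card_filter_lt_card (Multiset.mem_of_le hSX hu.mem) _ (lt_irrefl _))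
  · intro v hv _
    exact Nat.le_sub_one_of_lt
      (card_filter_lt_card (Multiset.mem_of_le hSX hv.mem) _ (lt_irrefl _))
  · intro u v hu _
    exact Nat.le_sub_one_of_lt
      (card_filter_lt_card (Multiset.mem_of_le hSX hu.mem) _ fun h => lt_irrefl _ h.1)

/-- The recurrence behind the bound for small inputs: every call is on at most `n - 1` elements. -/
theorem expectedCost_selectStep_le_crude (hH : Monotone H) :
    expectedCost (selectStep a b sel X k) ≤
      H (X.card - 1) + H (X.card - 1) + (X.card + X.card : ℕ) + H (X.card - 1) := by
  rw [selectStep_eq a b sel (by omega) k, expectedCost, expect_bind]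
  refine expect_le fun S hS => ?_
  obtain ⟨hSX, hSs⟩ := mem_support_uniformSample hS
  refine (expectedCost_selectWithSample_le_crude b ha hX hk1 hk hsel hH hSX hSs).trans ?_
  have := hH (Nat.le_sub_one_of_lt (sampleSize_lt a hX))
  gcongr

open Classical in
/-- The recurrence for the expected cost. The samples that are not unbalanced bring the final call
down to `2 D` elements; the others are accounted for at full size. -/
theorem expectedCost_selectStep_le (hH : Monotone H) {D : ℕ}
    (hD : 2 * gap a b X.card ≤ (D : ℝ) * sampleSize a X.card / X.card) :
    expectedCost (selectStep a b sel X k) ≤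
      (H (sampleSize a X.card) + H (sampleSize a X.card) +
        (X.card + (min k (X.card - k) + D) : ℕ) + H (2 * D)) +
      ENNReal.ofReal (4 * Real.exp (-2 * gap a b X.card ^ 2 / sampleSize a X.card)) *
        (X.card + H X.card) := by
  have hsp := sampleSize_pos ha hX
  have hb := rankBounds a b (by omega) hsp hk1 hk
  have hsl := sampleSize_lt a hX
  have hcrude (S : Multiset T) :=
    expectedCost_selectWithSample_le_crude b ha hX hk1 hk hsel hH (S := S)
  rw [selectStep_eq a b sel (by omega) k, expectedCost, expect_bind]
  obtain ⟨n, x, hx, rfl, hn⟩ : ∃ (n : ℕ) (x : Fin n → T), Monotone x ∧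
      Finset.univ.val.map x = X ∧ X.card = n := by
    obtain ⟨x, hx, hX⟩ := exists_monotone_map_eq X
    exact ⟨_, x, hx, hX, rfl⟩
  rw [expect_uniformSample_map]
  rw [hn] at hsp hb hsl hD hX hk hcrude ⊢
  set s := sampleSize a n
  set g := gap a b n
  set P := (Finset.univ : Finset (Fin n)).powersetCard s
  set A := H s + H s + (n + (min k (n - k) + D) : ℕ) + H (2 * D) with hA
  set B := (n : ℝ≥0∞) + H n with hB
  have hmain : ∀ t ∈ P, expectedCost (selectWithSample sel (Finset.univ.val.map x) (t.val.map x) k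
      (lowRank a b n k) (highRank a b n k)) ≤ A + if Unbalanced n s k D g t then B else 0 := by
    intro t ht
    have htc : t.card = s := Finset.mem_powersetCard_univ.1 ht
    have hSX : t.val.map x ≤ Finset.univ.val.map x :=
      Multiset.map_le_map (Finset.val_le_iff.2 (Finset.subset_univ t))
    have hSs : (t.val.map x).card = s := by rw [Multiset.card_map]; exact htc
    split_ifs with hbal
    · refine (hcrude _ hSX hSs).trans ?_
      have h1 : H (n - 1) ≤ H n := hH (Nat.sub_le n 1)
      calc _ ≤ H s + H s + (n + n : ℕ) + H n := by gcongr
        _ = (H s + H s + (n : ℕ)) + (n + H n) := by push_cast; ring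
        _ ≤ A + B := by
          rw [hA, hB]
          gcongr ?_ + _
          refine le_trans ?_ le_self_add
          gcongr
          omega
    · rw [add_zero]
      have h := expectedCost_selectWithSample_le hsel hSX (by rw [hSs, hn]; exact hsl) hb.pos hb.le
        (by rw [hSs]; exact hb.le_s) hk1 (by rwa [hn]) hH (N := min k (n - k) + D) (m := 2 * D)
        ?_ ?_ ?_ ?_
      · rwa [hSs, hn] at h
      · intro u v hu hv
        rw [hn]
        split_ifs with h
        · have := card_below_v_lt hx hb hD hbal hv
          omega
        · have := card_above_u_lt hx hk hb hD htc hbal hu (by omega)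
          omega
      · intro u hu h
        have := card_below_u_lt hx hb hD hbal hu h
        omega
      · intro v hv h
        rw [hn] at h
        have := card_above_v_lt hx hk hb hD htc hbal hv (by omega) (by omega)
        omega
      · intro u v hu hv
        exact card_between_le hx hk hb hD htc hbal hu hv (by omega)
  have hbad : ((P.filter (Unbalanced n s k D g)).card : ℝ≥0∞) ≤
      ENNReal.ofReal (4 * Real.exp (-2 * g ^ 2 / s)) * (n.choose s : ℕ) := by
    have := ENNReal.ofReal_le_ofReal (card_unbalanced_le (k := k) (D := D) hsl.le hsp hb.nonneg)
    rwa [mul_comm, ENNReal.ofReal_mul (by positivity), ENNReal.ofReal_natCast,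
      ENNReal.ofReal_natCast] at this
  refine ENNReal.div_le_of_le_mul ?_
  refine (Finset.sum_le_sum hmain).trans ?_
  rw [Finset.sum_add_distrib, Finset.sum_const, ← Finset.sum_filter, Finset.sum_const,
    Finset.card_powersetCard, Finset.card_univ, Fintype.card_fin, nsmul_eq_mul, nsmul_eq_mul,
    add_mul, mul_comm A]
  refine add_le_add le_rfl ?_
  rw [mul_right_comm]
  gcongr

end Step

section Induction

variable {T : Type u} [LinearOrder T]

theorem selectStep_of_card_eq_one (a b : ℝ) (sel : Multiset T → ℕ → PMF (Selection T × ℕ∞))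
    {X : Multiset T} (hX : X.card = 1) :
    ∃ x, X = {x} ∧ ∀ k, selectStep a b sel X k = PMF.pure (⟨x, 0, X, 0⟩, 0) :=
  ⟨_, (Multiset.card_eq_one.mp hX).choose_spec, fun k => by rw [selectStep, dif_pos hX]⟩

theorem isSelection_singleton (x : T) : IsSelection {x} 1 ⟨x, 0, {x}, 0⟩ where
  lt := (Multiset.filter_eq_nil.2 fun y hy => by simp_all).symm
  eq := (Multiset.filter_eq_self.2 fun y hy => by simp_all).symm
  gt := (Multiset.filter_eq_nil.2 fun y hy => by simp_all).symm
  card_lt := by simp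
  le_card := by simp

variable [Nonempty T] {a : ℝ} (ha : 0 < a) (b : ℝ)

include ha

/-- `Select` is correct, and its cost has a bound that depends only on the size of the input. -/
theorem selectAux_correct_and_crude (d : ℕ) : ∀ (X : Multiset T) (k : ℕ), 1 ≤ k → k ≤ X.card →
    X.card < d + 1 → (∀ r ∈ (selectAux a b d X k).support, IsSelection X k r.1) ∧
      expectedCost (selectAux a b d X k) ≤ ((4 ^ X.card : ℕ) : ℝ≥0∞) := by
  induction d with
  | zero => intro X k h1 h2 h3; omega
  | succ d ih =>
    intro X k hk1 hk hd
    change (∀ r ∈ (selectStep a b (selectAux a b d) X k).support, IsSelection X k r.1) ∧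
      expectedCost (selectStep a b (selectAux a b d) X k) ≤ _
    rcases (show X.card = 1 ∨ 2 ≤ X.card by omega) with hX | hX
    · obtain ⟨x, rfl, hx⟩ := selectStep_of_card_eq_one a b (selectAux a b d) hX
      rw [hx]
      obtain rfl : k = 1 := by omega
      refine ⟨fun r hr => ?_, ?_⟩
      · rw [PMF.mem_support_pure_iff] at hr
        subst hr
        exact isSelection_singleton x
      · rw [expectedCost, expect_pure]; simp
    · have hs : Solves (selectAux a b d) (fun m => ((4 ^ m : ℕ) : ℝ≥0∞)) X.card :=
        fun Y j hj1 hj hY => ih Y j hj1 hj (by omega)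
      have hH : Monotone fun m : ℕ => ((4 ^ m : ℕ) : ℝ≥0∞) := fun m m' h =>
        Nat.cast_le.2 (Nat.pow_le_pow_right (by norm_num) h)
      refine ⟨isSelection_selectStep b ha hX hk1 hk hs, ?_⟩
      refine (expectedCost_selectStep_le_crude b ha hX hk1 hk hs hH).trans ?_
      norm_cast
      obtain ⟨m, hm⟩ : ∃ m, X.card = m + 2 := ⟨X.card - 2, by omega⟩
      rw [hm, show m + 2 - 1 = m + 1 from rfl, pow_succ 4 (m + 1), pow_succ]
      have : m + 1 ≤ 4 ^ m := Nat.lt_pow_self (by norm_num)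
      omega

end Induction

/-! ### The solution of the recurrence -/

section Rate
open Filter Topology

theorem rate_mono : Monotone rate := by
  intro m n h
  rcases Nat.eq_zero_or_pos m with rfl | hm
  · rw [rate]
    simpa using rate_nonneg n
  · have hm' : (0 : ℝ) < m := by exact_mod_cast hm
    have h' : (m : ℝ) ≤ n := by exact_mod_cast h
    unfold rate
    have h1 := Real.log_le_log hm' h'
    have h2 := Real.log_natCast_nonneg m
    gcongr

theorem rate_pow_three (n : ℕ) : rate n ^ 3 = (n : ℝ) ^ 2 * Real.log n := by
  have h := Real.log_natCast_nonneg n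
  rw [rate, mul_pow, ← Real.rpow_natCast, ← Real.rpow_mul n.cast_nonneg, ← Real.rpow_natCast,
    ← Real.rpow_mul h]
  norm_num

theorem one_le_log {n : ℕ} (hn : 3 ≤ n) : 1 ≤ Real.log n := by
  have h : (3 : ℝ) ≤ n := by exact_mod_cast hn
  rw [Real.le_log_iff_exp_le (by linarith)]
  linarith [Real.exp_one_lt_d9]

theorem rpow_le_rate {n : ℕ} (hn : 3 ≤ n) : (n : ℝ) ^ (2 / 3 : ℝ) ≤ rate n :=
  le_mul_of_one_le_right (by positivity) (Real.one_le_rpow (one_le_log hn) (by norm_num))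

theorem one_le_rate {n : ℕ} (hn : 3 ≤ n) : 1 ≤ rate n := by
  refine le_trans ?_ (rpow_le_rate hn)
  exact Real.one_le_rpow (by exact_mod_cast (by omega : 1 ≤ n)) (by norm_num)

theorem tendsto_rate_div : Tendsto (fun n : ℕ => rate n / n) atTop (𝓝 0) := by
  have h1 : Tendsto (fun n : ℕ => (Real.log n / n) ^ (1 / 3 : ℝ)) atTop (𝓝 0) := by
    have h2 : Tendsto (fun n : ℕ => Real.log n / (n : ℝ)) atTop (𝓝 0) :=
      (Real.isLittleO_log_id_atTop.tendsto_div_nhds_zero).comp tendsto_natCast_atTop_atTop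
    have h3 := h2.rpow_const (p := 1 / 3) (Or.inr (by norm_num))
    rwa [Real.zero_rpow (by norm_num)] at h3
  refine h1.congr' ?_
  filter_upwards [eventually_ge_atTop 3] with n hn
  have hn0 : (0 : ℝ) < n := by exact_mod_cast (by omega : 0 < n)
  rw [Real.div_rpow (Real.log_natCast_nonneg n) hn0.le, rate,
    div_eq_div_iff (by positivity) hn0.ne', mul_right_comm, ← Real.rpow_add hn0]
  norm_num
  ring

theorem eventually_mul_rate_le (c : ℝ) {e : ℝ} (he : 0 < e) :
    ∀ᶠ n : ℕ in atTop, c * rate n ≤ e * n := by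
  have h := (tendsto_rate_div.const_mul c)
  rw [mul_zero] at h
  filter_upwards [h.eventually_le_const he, eventually_gt_atTop 0] with n hn h0
  have hn0 : (0 : ℝ) < n := by exact_mod_cast h0
  rwa [← mul_div_assoc, div_le_iff₀ hn0] at hn

/-- If `m ≤ n`, then `f m / f n ≤ (m / n) ^ (2 / 3)`, so that `f (O (f n)) = o (f n)`. -/
theorem eventually_rate_le (c : ℝ) {e : ℝ} (he : 0 < e) :
    ∀ᶠ n : ℕ in atTop, ∀ m : ℕ, (m : ℝ) ≤ c * rate n → rate m ≤ e * rate n := by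
  set e' : ℝ := min 1 (e ^ (3 / 2 : ℝ)) with he'
  have he0 : 0 < e' := lt_min one_pos (Real.rpow_pos_of_pos he _)
  filter_upwards [eventually_mul_rate_le c he0, eventually_gt_atTop 0] with n hn hpos m hm
  rcases Nat.eq_zero_or_pos m with rfl | hm0
  · have : rate 0 = 0 := by rw [rate]; simp
    rw [this]
    exact mul_nonneg he.le (rate_nonneg n)
  have hm0' : (0 : ℝ) < m := by exact_mod_cast hm0
  have hmn : (m : ℝ) ≤ e' * n := hm.trans hn
  have hmn1 : (m : ℝ) ≤ n := hmn.trans (mul_le_of_le_one_left n.cast_nonneg (min_le_left _ _))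
  have hlog := Real.log_le_log hm0' hmn1
  have hlog0 := Real.log_natCast_nonneg m
  have h1 : (m : ℝ) ^ (2 / 3 : ℝ) ≤ e * (n : ℝ) ^ (2 / 3 : ℝ) := by
    calc (m : ℝ) ^ (2 / 3 : ℝ) ≤ (e ^ (3 / 2 : ℝ) * n) ^ (2 / 3 : ℝ) := by
          gcongr
          exact hmn.trans (by gcongr; exact min_le_right _ _)
      _ = _ := by
          rw [Real.mul_rpow (by positivity) n.cast_nonneg, ← Real.rpow_mul he.le]
          norm_num
  calc rate m ≤ (e * (n : ℝ) ^ (2 / 3 : ℝ)) * Real.log n ^ (1 / 3 : ℝ) := by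
        unfold rate; gcongr
    _ = _ := by rw [rate, mul_assoc]

end Rate

section Recurrence
open Filter Topology

variable {a b : ℝ}

/-- The gap is chosen so that the tail bound is a power of `n`. -/
theorem exp_gap_eq {n : ℕ} (hb : 0 ≤ b) (hn : 0 < n) (hs : 0 < sampleSize a n) :
    Real.exp (-2 * gap a b n ^ 2 / sampleSize a n) = (n : ℝ) ^ (-2 * b) := by
  have hn0 : (0 : ℝ) < n := by exact_mod_cast hn
  have hs0 : (0 : ℝ) < sampleSize a n := by exact_mod_cast hs
  have := Real.log_natCast_nonneg n
  rw [gap, Real.sq_sqrt (by positivity), Real.rpow_def_of_pos hn0]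
  congr 1
  field_simp

/-- The squares compare because of `f n ^ 3 = n ^ 2 ln n`: the sample size balances the cost of the
sample against the width `g n / s` of the range that it leaves. -/
theorem gap_mul_div_le (hb : 0 ≤ b) (ha : 0 < a) {n : ℕ} (hn : 3 ≤ n)
    (hs : a * rate n ≤ sampleSize a n) :
    gap a b n * n / sampleSize a n ≤ Real.sqrt (b / a) * rate n := by
  have hr := rate_pos (show 2 ≤ n by omega)
  have hs0 : (0 : ℝ) < sampleSize a n := (mul_pos ha hr).trans_le hs
  have := Real.log_natCast_nonneg n
  refine le_of_sq_le_sq ?_ (by positivity)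
  rw [mul_pow, Real.sq_sqrt (by positivity), div_pow, mul_pow, gap, Real.sq_sqrt (by positivity)]
  calc b * sampleSize a n * Real.log n * (n : ℝ) ^ 2 / (sampleSize a n : ℝ) ^ 2
      = b * ((n : ℝ) ^ 2 * Real.log n) / sampleSize a n := by field_simp
    _ = b * rate n ^ 3 / sampleSize a n := by rw [rate_pow_three]
    _ ≤ b * rate n ^ 3 / (a * rate n) := by gcongr
    _ = b / a * rate n ^ 2 := by field_simp

/-- The half-width, in ranks of the input, of the interval in which the pivots are expected. -/
noncomputable def spread (a b : ℝ) (n : ℕ) : ℕ :=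
  ⌈2 * (gap a b n * n / sampleSize a n)⌉₊

theorem two_mul_gap_le {n : ℕ} (hn : 0 < n) (hs : 0 < sampleSize a n) :
    2 * gap a b n ≤ (spread a b n : ℝ) * sampleSize a n / n := by
  have hn0 : (0 : ℝ) < n := by exact_mod_cast hn
  have hs0 : (0 : ℝ) < sampleSize a n := by exact_mod_cast hs
  rw [le_div_iff₀ hn0, ← div_le_iff₀ hs0]
  refine le_trans (le_of_eq ?_) (Nat.le_ceil _)
  ring

/-- For large `n`, the terms of the recurrence that do not involve `γ` are `O (f n)`, and the
coefficient of `γ` is at most `f n / 2`. -/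
theorem eventually_recurrence (ha : 0 < a) (hb : 1 / 6 ≤ b) :
    ∃ C : ℝ, 0 < C ∧ ∀ᶠ n : ℕ in atTop,
      4 * (sampleSize a n : ℝ) + 5 * spread a b n + 4 * (n : ℝ) ^ (-2 * b) * (3 * n) ≤
        C * rate n ∧
      2 * rate (sampleSize a n) + rate (2 * spread a b n) + 4 * (n : ℝ) ^ (-2 * b) * rate n ≤
        1 / 2 * rate n := by
  set c : ℝ := 2 * Real.sqrt (b / a) + 1 with hc
  have hc0 : 0 < c := by positivity
  refine ⟨4 * (a + 1) + 5 * c + 12, by positivity, ?_⟩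
  have hpow : ∀ᶠ n : ℕ in atTop, 4 * (n : ℝ) ^ (-2 * b) ≤ 1 / 8 := by
    have h1 : Tendsto (fun n : ℕ => (n : ℝ) ^ (-(2 * b))) atTop (𝓝 0) :=
      (tendsto_rpow_neg_atTop (by linarith)).comp tendsto_natCast_atTop_atTop
    filter_upwards [h1.eventually_le_const (by norm_num : (0 : ℝ) < 1 / 32)] with n hn
    rw [neg_mul]
    linarith
  filter_upwards [eventually_ge_atTop 3, hpow, eventually_mul_rate_le a (e := 1 / 2) (by norm_num),
    eventually_rate_le (a + 1) (e := 1 / 8) (by norm_num),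
    eventually_rate_le (2 * c) (e := 1 / 8) (by norm_num)] with n hn hp hlin hr1 hr2
  have hn3 : (3 : ℝ) ≤ n := by exact_mod_cast hn
  have h1 := one_le_rate hn
  have hs_le : (sampleSize a n : ℝ) ≤ (a + 1) * rate n := by
    have h2 : (sampleSize a n : ℝ) ≤ ⌈a * rate n⌉₊ := Nat.cast_le.2 (min_le_left _ _)
    have h3 := Nat.ceil_lt_add_one (mul_pos ha (rate_pos (by omega : 2 ≤ n))).le
    linarith
  -- the bound `n - 1` in the sample size is not active for large `n`
  have hs_ge : a * rate n ≤ sampleSize a n := by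
    rw [sampleSize, Nat.cast_min, Nat.cast_sub (by omega), Nat.cast_one]
    exact le_min (Nat.le_ceil _) (by linarith)
  have hD : (spread a b n : ℝ) ≤ c * rate n := by
    have h2 := gap_mul_div_le (b := b) (by linarith) ha hn hs_ge
    have h3 : 0 ≤ gap a b n * n / sampleSize a n :=
      div_nonneg (mul_nonneg (Real.sqrt_nonneg _) n.cast_nonneg) (Nat.cast_nonneg _)
    have h4 : (spread a b n : ℝ) < 2 * (gap a b n * n / sampleSize a n) + 1 :=
      Nat.ceil_lt_add_one (by positivity)
    rw [hc, add_mul]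
    linarith
  -- the exponent `1 - 2 b` is at most `2 / 3`
  have hnb : (n : ℝ) ^ (-2 * b) * n ≤ rate n := by
    refine le_trans ?_ (rpow_le_rate hn)
    rw [← Real.rpow_add_one (by linarith)]
    exact Real.rpow_le_rpow_of_exponent_le (by linarith) (by linarith)
  refine ⟨by linarith, ?_⟩
  have h5 := hr1 _ hs_le
  have h6 := hr2 (2 * spread a b n) (by push_cast; linarith)
  have h7 : 4 * (n : ℝ) ^ (-2 * b) * rate n ≤ 1 / 8 * rate n := by gcongr
  linarith

end Recurrence

section Main

variable {T : Type u} [LinearOrder T] [Nonempty T] {a b : ℝ}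

/-- The asymptotic recurrence closes with any `γ ≥ 2 C`, once the claim holds for the
inputs of fewer than `N` elements. -/
theorem expectedCost_selectAux_le (ha : 0 < a) (hb : 0 ≤ b) {C γ : ℝ} {N : ℕ}
    (hγ : 0 ≤ γ) (hC : 2 * C ≤ γ) (hsmall : ∀ n : ℕ, 2 ≤ n → n < N → (4 : ℝ) ^ n ≤ γ * rate n)
    (hN : ∀ n : ℕ, N ≤ n →
      4 * (sampleSize a n : ℝ) + 5 * spread a b n + 4 * (n : ℝ) ^ (-2 * b) * (3 * n) ≤
        C * rate n ∧
      2 * rate (sampleSize a n) + rate (2 * spread a b n) + 4 * (n : ℝ) ^ (-2 * b) * rate n ≤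
        1 / 2 * rate n)
    (d : ℕ) : ∀ (X : Multiset T) (k : ℕ), 1 ≤ k → k ≤ X.card → X.card < d + 1 →
      expectedCost (selectAux a b d X k) ≤ ENNReal.ofReal
        ((X.card : ℝ) + min (k : ℝ) ((X.card : ℝ) - k) + γ * rate X.card) := by
  induction d with
  | zero => intro X k h1 h2 h3; omega
  | succ d ih =>
    intro X k hk1 hk hd
    have hk' : (k : ℝ) ≤ X.card := by exact_mod_cast hk
    have hmin0 : 0 ≤ min (k : ℝ) ((X.card : ℝ) - k) := le_min k.cast_nonneg (by linarith)
    rcases (show X.card = 1 ∨ 2 ≤ X.card by omega) with hX | hX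
    · obtain ⟨x, -, hx⟩ := selectStep_of_card_eq_one a b (selectAux (T := T) a b d) hX
      change expectedCost (selectStep a b (selectAux a b d) X k) ≤ _
      rw [hx, expectedCost, expect_pure]
      simp
    rcases lt_or_ge X.card N with hXN | hXN
    · refine (selectAux_correct_and_crude ha b (d + 1) X k hk1 hk hd).2.trans ?_
      rw [← ENNReal.ofReal_natCast]
      refine ENNReal.ofReal_le_ofReal ?_
      have := hsmall _ hX hXN
      push_cast
      have : (0 : ℝ) ≤ X.card := Nat.cast_nonneg _
      linarith
    set H : ℕ → ℝ≥0∞ := fun m => ENNReal.ofReal (2 * m + γ * rate m) with hH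
    have hHm : Monotone H := by
      intro m m' h
      have h1 : (m : ℝ) ≤ m' := by exact_mod_cast h
      have h2 := rate_mono h
      refine ENNReal.ofReal_le_ofReal ?_
      gcongr
    -- `min {j, m - j} ≤ m - 1` weakens the claim for the recursive calls to `H`
    have hs : Solves (selectAux (T := T) a b d) H X.card := by
      intro Y j hj1 hj hY
      refine ⟨(selectAux_correct_and_crude ha b d Y j hj1 hj (by omega)).1,
        (ih Y j hj1 hj (by omega)).trans (ENNReal.ofReal_le_ofReal ?_)⟩
      have h1 : (1 : ℝ) ≤ j := by exact_mod_cast hj1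
      have h2 := min_le_right (j : ℝ) ((Y.card : ℝ) - j)
      linarith
    have hsp := sampleSize_pos ha hX
    refine (expectedCost_selectStep_le b ha hX hk1 hk hs hHm
      (two_mul_gap_le (by omega) hsp)).trans ?_
    rw [exp_gap_eq hb (by omega) hsp]
    obtain ⟨e1, e2⟩ := hN _ hXN
    set n := X.card
    set s := sampleSize a n
    set D := spread a b n
    set p := (n : ℝ) ^ (-2 * b)
    have hp : 0 ≤ p := by positivity
    have hr (m : ℕ) : 0 ≤ γ * rate m := mul_nonneg hγ (rate_nonneg m)
    have hHr (m : ℕ) : 0 ≤ 2 * (m : ℝ) + γ * rate m := add_nonneg (by positivity) (hr m)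
    have hmin : ((min k (n - k) : ℕ) : ℝ) = min (k : ℝ) ((n : ℝ) - k) := by
      rw [Nat.cast_min, Nat.cast_sub hk]
    simp only [hH]
    rw [← ENNReal.ofReal_natCast, ← ENNReal.ofReal_natCast,
      ← ENNReal.ofReal_add (hHr _) (hHr _), ← ENNReal.ofReal_add (by linarith [hHr s]) (by positivity),
      ← ENNReal.ofReal_add (by have := hHr s; positivity) (hHr _),
      ← ENNReal.ofReal_add (by positivity) (hHr _), ← ENNReal.ofReal_mul (by positivity),
      ← ENNReal.ofReal_add]
    · refine ENNReal.ofReal_le_ofReal ?_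
      rw [Nat.cast_add, Nat.cast_add, hmin]
      push_cast
      have e3 : γ * (2 * rate s + rate (2 * D) + 4 * p * rate n) ≤ γ * (1 / 2 * rate n) :=
        mul_le_mul_of_nonneg_left e2 hγ
      have e4 : C * rate n ≤ γ / 2 * rate n :=
        mul_le_mul_of_nonneg_right (by linarith) (rate_nonneg n)
      linarith
    · have := hHr s; have := hHr (2 * D); positivity
    · have := hHr n; positivity

end Main
end FloydRivest

theorem theoremt (a b : ℝ) (ha : 0 < a) (hb : 1 / 6 ≤ b) :
    ∃ γ : ℝ, 0 < γ ∧
      ∀ (T : Type*) [LinearOrder T] [Nonempty T] (X : Multiset T) (k : ℕ),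
        1 ≤ k → k ≤ X.card →
          FloydRivest.expectedComparisons a b X k ≤
            ENNReal.ofReal ((X.card : ℝ) + min (k : ℝ) ((X.card : ℝ) - k)
              + γ * FloydRivest.rate X.card) := by
  obtain ⟨C, hC, hev⟩ := FloydRivest.eventually_recurrence ha hb
  obtain ⟨N, hN⟩ := Filter.eventually_atTop.1 hev
  have hr2 := FloydRivest.rate_pos le_rfl
  -- the second term covers the inputs of fewer than `N + 2` elements, as `rate` increases from
  -- `rate 2 > 0`; a single element costs nothing
  refine ⟨max (2 * C) (4 ^ (N + 2) / FloydRivest.rate 2),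
    lt_max_of_lt_left (by linarith), fun T _ _ X k hk1 hk => ?_⟩
  refine FloydRivest.expectedCost_selectAux_le ha (by linarith) (N := N + 2)
    (le_max_of_le_left (by linarith)) (le_max_left _ _) ?_ (fun n hn => hN n (by omega))
    X.card X k hk1 hk (Nat.lt_succ_self _)
  intro n hn hnN
  calc (4 : ℝ) ^ n ≤ 4 ^ (N + 2) := pow_le_pow_right₀ (by norm_num) hnN.le
    _ = 4 ^ (N + 2) / FloydRivest.rate 2 * FloydRivest.rate 2 := by field_simp
    _ ≤ _ := by
      gcongr
      · exact le_max_right _ _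
      · exact FloydRivest.rate_mono hn
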